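/- **Setting.** Let $\kappa,c_v,\mathcal A,T_\infty,\mu_l,\rho_l,\sigma,\bar\sigma>0$ be constants, $\gamma=1+\mathcal A/c_v$ (write $\mathcal AT=\mathcal A T_\infty$). An *equilibrium* in $\Sigma$ is given by a gas mass $M>0$, a liquid volume $V>0$ and $\rho_\dagger,R_\dagger>0$ with $$\tfrac{4\pi}{3}\rho_\dagger R_\dagger^3=M,\qquad \rho_\dagger=\frac{2}{\mathcal AT}\Big(\frac{\sigma}{R_\dagger}+\frac{\bar\sigma}{\bar R_\dagger}\Big),\qquad \bar R_\dagger=(R_\dagger^3+\bar V)^{1/3},\quad \bar V=\frac{3V}{4\pi}.$$ Fix one. For $k\ge1$ put $\lambda_k=(k\pi)^2$, $\Xi_k(y)=\frac{\sin(k\pi y)}{\sqrt{2\pi}\,y}$, $\tilde R=R_\dagger-R_\dagger^2/\bar R_\dagger$, $\bar\kappa=\frac{\kappa}{R_\dagger^2\rho_\dagger\gamma c_v}$, $c_k=\frac{(-1)^{k-1}2^{3/2}(\gamma-1)}{\sqrt\pi\,\gamma k}$, $\omega_k=-\frac{R_\dagger\bar\kappa}{\rho_\dagger}\sqrt{\tfrac{\pi}{2}}(-1)^kk$,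 $A=\frac{2\sigma}{R_\dagger^2}+\frac{2\bar\sigma R_\dagger^2}{\bar R_\dagger^4}$, $F=\frac{3\gamma\rho_\dagger}{R_\dagger}$. For $\mathbf z=(\rho_2,\mathcal R,\mathcal V,\theta_1,\theta_2,\dots)\in\ell^2$ ($\mathcal V$ stands for the velocity $\dot R$) write $R=R_\dagger+\mathcal R$, $\bar R=(R^3+\bar V)^{1/3}$, $\rho_1=\sum_j\theta_j\Xi_j$, $\rho=\rho_\dagger+\rho_2+\rho_1$ (functions of $y=|x|\in[0,1]$), and let $\mathbf w\in\ell^2$ have entries $w_0,w_1,w_2,\dots$ Define $$\mathcal L\mathbf z=\Big(F\big(\textstyle\sum_j\omega_j\theta_j-\mathcal V\big),\ \mathcal V,\ \frac{1}{\rho_l\tilde R}\Big[\mathcal AT\rho_2+A\mathcal R-\frac{4\mu_l\bar V}{R_\dagger(R_\dagger^3+\bar V)}\mathcal V\Big],\ \big(-c_kF(\textstyle\sum_j\omega_j\theta_j-\mathcal V)-\bar\kappa\lambda_k\theta_k\big)_{k\ge1}\Big),$$ $$\Pi=\frac{w_0}{\gamma(\rho_\dagger+\rho_2)}\Big(\frac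 y3\partial_y\rho_1+\rho_1\Big)-\frac{\kappa}{\gamma c_v}\frac{|\partial_y\rho_1|^2}{R^2\rho^2}-\frac{\kappa}{\gamma c_v}\Big[\frac1{R^2\rho}-\frac1{R_\dagger^2\rho_\dagger}\Big]\sum_j\lambda_j\theta_j\Xi_j,\qquad \Pi_k=\int_{B_1}\Pi\,\Xi_k,$$ $$\Phi=\Big(-\frac{\mathcal R}{3\gamma(\rho_\dagger+\rho_2)}+\frac{R_\dagger\rho_2}{3\gamma\rho_\dagger(\rho_\dagger+\rho_2)}\Big)w_0-\frac{\kappa}{\gamma c_v}\Big[\frac1{R(\rho_\dagger+\rho_2)^2}-\frac1{R_\dagger\rho_\dagger^2}\Big]\sum_j\sqrt{\tfrac\pi2}(-1)^jj\theta_j,$$ $$\Psi=\frac{\rho_l}{\mathcal AT}\Big[\mathcal R+\frac{R_\dagger^2}{\bar R_\dagger}-\frac{R^2}{\bar R}\Big]w_2+\frac1{\mathcal AT}\Big[4\mu_l\bar V\Big(\frac1{R(R^3+\bar V)}-\frac1{R_\dagger(R_\dagger^3+\bar V)}\Big)\mathcal V+A\mathcal R+\frac{2\sigma}{R}-\frac{2\sigma}{R_\dagger}+\frac{2\bar\sigma}{\bar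 R}-\frac{2\bar\sigma}{\bar R_\dagger}+\rho_l\Big(\frac32-\frac{2R}{\bar R}+\frac{R^4}{2\bar R^4}\Big)\mathcal V^2\Big],$$ $$\mathcal N(\mathbf z,\mathbf w)=\Big(F\Phi,\ 0,\ -\frac{\mathcal AT}{\rho_l\tilde R}\Psi,\ (\Pi_k-c_kF\Phi)_{k\ge1}\Big)=\mathcal N^1(\mathbf z)\mathbf w+\mathcal N^0(\mathbf z),$$ where $\mathcal N^1(\mathbf z)\mathbf w$ is the part linear in $\mathbf w$ and $\mathcal N^0(\mathbf z)=\mathcal N(\mathbf z,\mathbf 0)$. Let $\mathbf U=(-\tfrac{A}{\mathcal AT},1,0,0,\dots)$, $X=\mathrm{span}(\mathbf U)$, $\Upsilon=(\tfrac{4\pi}3,\tfrac{4\pi\rho_\dagger}{R_\dagger},0,\tfrac{\gamma c_1}{\gamma-1},\tfrac{\gamma c_2}{\gamma-1},\dots)$, $\Upsilon_0=\Upsilon/\langle\Upsilon,\mathbf U\rangle$, $\mathcal Q_1\mathbf z=\langle\Upsilon_0,\mathbf z\rangle\mathbf U$, $\mathcal Q_2=I-\mathcal Q_1$. The *decomposed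 system* is $$\dot{\mathbf x}=\mathcal Q_1\mathcal N(\mathbf x+\mathbf y,\dot{\mathbf x}+\dot{\mathbf y}),\qquad \dot{\mathbf y}=\mathcal L\mathbf y+\mathcal Q_2\mathcal N(\mathbf x+\mathbf y,\dot{\mathbf x}+\dot{\mathbf y}),\qquad \mathbf x(t)\in X,\ \mathbf y(t)\in\ell^2 .\tag{S}$$ A *solution* on $[0,T)$ is a pair of $C^1$ curves $\mathbf x:[0,T)\to X$, $\mathbf y:[0,T)\to\ell^2$ that satisfies (S), such that for $\mathbf z=\mathbf x+\mathbf y$ the sequence $(j^2\theta_j)_j$ is a continuous curve in $\ell^2$, and $R>0$, $\rho>0$ on $[0,1]$ at all times. **Proposition 4.4.** Let $\hat R:\mathbb R\to(0,\infty)$ be $C^1$ with $\hat R(0)=R_\dagger$ and $\hat R'(0)\ne1$, and put for $\alpha\in\mathbb R$ $$\hat\rho(\alpha)=\frac1{\mathcal AT}\Big(\frac{2\sigma}{\hat R(\alpha)}+\frac{2\bar\sigma}{(\hat R(\alpha)^3+\bar V)^{1/3}}\Big),\qquad h(\alpha\mathbf U)=\Big(\hat\rho(\alpha)+\frac{A}{\mathcal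 AT}\alpha-\rho_\dagger,\ \hat R(\alpha)-\alpha-R_\dagger,\ 0,0,\dots\Big)\in\ell^2 .$$ Then: 1. $\hat\rho(0)=\rho_\dagger$. 2. The curve $\mathbf y=h(\mathbf x)$, $\mathbf x\in X$, is a global center manifold for (S): $h:X\to\ell^2$ is $C^1$, $h(\mathbf 0)=\mathbf 0$, the curve $h$ is tangent to $X$ at the origin (the range of $h'(\mathbf 0)$ is $X$), and $h$ is invariant: for every $\mathbf x_0\in X$ there is a solution of (S) on $[0,\infty)$ with initial value $(\mathbf x_0,h(\mathbf x_0))$, and every solution on any $[0,T)$ with this initial value satisfies $\mathbf y(t)=h(\mathbf x(t))$ for $t\in[0,T)$. Moreover, every solution with $\mathbf x(0)+\mathbf y(0)$ on the curve $\{\alpha\mathbf U+h(\alpha\mathbf U):\alpha\in\mathbb R\}$ keeps $\mathbf x(t)+\mathbf y(t)$ on that curve. 3. There is $\delta>0$ such that for every $T>0$ and every $\alpha:[0,T)\to(-\delta,\delta)$, the function $\mathbf x(t)=\alpha(t)\mathbf U$ is a (differentiable) solution of the equation on the center manifold $$\dot{\mathbf x}=\mathcal Q_1\big[\mathcal N^1(\mathbf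 x+h(\mathbf x))[\dot{\mathbf x}+h'(\mathbf x)\dot{\mathbf x}]\big]+\mathcal Q_1\mathcal N^0(\mathbf x+h(\mathbf x))\tag{C}$$ if and only if $\dot\alpha\equiv0$. 4. The zero solution of (C) is Lyapunov stable: $\mathbf 0$ is a solution, and for every $\varepsilon>0$ there is $\eta>0$ such that for each $\mathbf x_0\in X$ with $\|\mathbf x_0\|<\eta$ there is a solution of (C) on $[0,\infty)$ starting at $\mathbf x_0$, and every solution on any $[0,T)$ starting at $\mathbf x_0$ satisfies $\|\mathbf x(t)\|<\varepsilon$. -/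

import Mathlib

open Set

noncomputable section

/-- The physical constants of the gas-liquid system. -/
structure BubbleParams where
  /-- thermal conductivity of the gas -/
  kap : ℝ
  /-- specific heat capacity of the gas -/
  cv : ℝ
  /-- ideal gas constant divided by the molar mass -/
  gasA : ℝ
  /-- exterior temperature -/
  Tinf : ℝ
  /-- dynamic viscosity of the liquid -/
  mul : ℝ
  /-- density of the liquid -/
  rhol : ℝ
  /-- surface tension of the gas-liquid interface -/
  sig : ℝ
  /-- surface tension of the exterior free surface -/
  sigbar : ℝ
  kap_pos : 0 < kap
  cv_pos : 0 < cv
  gasA_pos : 0 < gasA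
  Tinf_pos : 0 < Tinf
  mul_pos : 0 < mul
  rhol_pos : 0 < rhol
  sig_pos : 0 < sig
  sigbar_pos : 0 < sigbar

namespace BubbleParams

/-- The adiabatic constant `γ = 1 + 𝒜 / c_v`. -/
def gam (P : BubbleParams) : ℝ := 1 + P.gasA / P.cv

/-- Exterior radius `(R³ + 3V/(4π))^{1/3}` of the gas-liquid ball whose gas bubble has radius `R`
and whose liquid has volume `V`. -/
def outer (V R : ℝ) : ℝ := (R ^ 3 + 3 * V / (4 * Real.pi)) ^ ((1 : ℝ) / 3)

end BubbleParams

/-- A spherical equilibrium, i.e. a point of the manifold `Σ`: gas mass `M > 0`, liquid volume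
`V > 0`, and the corresponding constant gas density `rho` and bubble radius `R`. -/
structure Equilibrium (P : BubbleParams) where
  M : ℝ
  V : ℝ
  rho : ℝ
  R : ℝ
  M_pos : 0 < M
  V_pos : 0 < V
  rho_pos : 0 < rho
  R_pos : 0 < R
  mass_eq : 4 * Real.pi / 3 * rho * R ^ 3 = M
  density_eq : rho = 2 / (P.gasA * P.Tinf) * (P.sig / R + P.sigbar / BubbleParams.outer V R)

/-- The real Hilbert space `ℓ²`. A point is written
`z = (ρ₂, ℛ, Ṙ, θ₁, θ₂, …)`: entry `0` is the boundary density perturbation `ρ₂`, entry `1` the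
radius perturbation `ℛ`, entry `2` the radius velocity, and entry `j + 3` the coefficient
`θ_{j+1}` of the interior density perturbation. All sequences below that are indexed by `j = 1, 2, …`
in the mathematics are indexed by `j = 0, 1, …` here, shifted by one. -/
abbrev EllTwo : Type := lp (fun _ : ℕ => ℝ) 2

/-- The vector `(a, b, 0, 0, …)` of `ℓ²`. -/
def twoVec (a b : ℝ) : EllTwo := lp.single 2 (0 : ℕ) a + lp.single 2 (1 : ℕ) b

theorem twoVec_zero (a b : ℝ) : twoVec a b 0 = a := by
  change (lp.single 2 (0 : ℕ) a : EllTwo) 0 + (lp.single 2 (1 : ℕ) b : EllTwo) 0 = a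
  simp [lp.single_apply]

theorem twoVec_one (a b : ℝ) : twoVec a b 1 = b := by
  change (lp.single 2 (0 : ℕ) a : EllTwo) 1 + (lp.single 2 (1 : ℕ) b : EllTwo) 1 = b
  simp [lp.single_apply]

theorem twoVec_of_two_le (a b : ℝ) (n : ℕ) : twoVec a b (n + 2) = 0 := by
  change (lp.single 2 (0 : ℕ) a : EllTwo) (n + 2) + (lp.single 2 (1 : ℕ) b : EllTwo) (n + 2) = 0
  simp [lp.single_apply]

/-- The pairing `⟨a, b⟩ = ∑ aₙ bₙ`. -/
def pairing (a b : ℕ → ℝ) : ℝ := ∑' n, a n * b n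

/-- The normalized radial Dirichlet eigenfunction `Ξ_{j+1}` of the unit ball, that is
`sin((j+1)πy) / (√(2π) y)` for `y ≠ 0`, extended continuously to `y = 0`. -/
def eigFun (j : ℕ) (y : ℝ) : ℝ :=
  ((j : ℝ) + 1) * Real.pi / Real.sqrt (2 * Real.pi) * Real.sinc (((j : ℝ) + 1) * Real.pi * y)

/-- The eigenvalue `λ_{j+1} = ((j+1)π)²`. -/
def eigVal (j : ℕ) : ℝ := (((j : ℝ) + 1) * Real.pi) ^ 2

/-- The integral `∫_{B₁} f(|x|) dx` of a radial function over the unit ball of `ℝ³`. -/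
def ballInt (f : ℝ → ℝ) : ℝ := 4 * Real.pi * ∫ y in (0 : ℝ)..1, y ^ 2 * f y

/-- The interior density perturbation `ρ₁(y) = ∑ θ_j Ξ_j(y)` of the state `z`. -/
def rho1 (z : ℕ → ℝ) (y : ℝ) : ℝ := ∑' j, z (j + 3) * eigFun j y

/-- Its radial derivative `∂_y ρ₁(y) = ∑ θ_j Ξ_j'(y)`. -/
def rho1' (z : ℕ → ℝ) (y : ℝ) : ℝ := ∑' j, z (j + 3) * deriv (eigFun j) y

namespace Equilibrium

variable {P : BubbleParams}

/-- The equilibrium exterior radius. -/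
def Rbar (S : Equilibrium P) : ℝ := BubbleParams.outer S.V S.R

/-- The modified liquid volume `V̄ = 3V/(4π)`. -/
def Vbar (S : Equilibrium P) : ℝ := 3 * S.V / (4 * Real.pi)

/-- `R̃ = R† - R†² / R̄†`. -/
def Rtil (S : Equilibrium P) : ℝ := S.R - S.R ^ 2 / S.Rbar

/-- `κ̄ = κ / (R†² ρ† γ c_v)`. -/
def kbar (S : Equilibrium P) : ℝ := P.kap / (S.R ^ 2 * S.rho * P.gam * P.cv)

/-- `c_{j+1} = (-1)^j 2^{3/2} (γ - 1) / (√π γ (j+1))`. -/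
def coef (_S : Equilibrium P) (j : ℕ) : ℝ :=
  (-1) ^ j * (2 : ℝ) ^ ((3 : ℝ) / 2) * (P.gam - 1) / (Real.sqrt Real.pi * P.gam * ((j : ℝ) + 1))

/-- `ω_{j+1} = - (R† κ̄ / ρ†) √(π/2) (-1)^{j+1} (j+1)`. -/
def omg (S : Equilibrium P) (j : ℕ) : ℝ :=
  -(S.R * S.kbar / S.rho) * Real.sqrt (Real.pi / 2) * (-1) ^ (j + 1) * ((j : ℝ) + 1)

/-- The constant `2σ/(𝒜T R†²) + 2σ̄R†²/(𝒜T R̄†⁴)`. -/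
def slope (S : Equilibrium P) : ℝ :=
  2 * P.sig / (P.gasA * P.Tinf * S.R ^ 2)
    + 2 * P.sigbar * S.R ^ 2 / (P.gasA * P.Tinf * S.Rbar ^ 4)

/-- The factor `3γρ†/R†`. -/
def fac (S : Equilibrium P) : ℝ := 3 * P.gam * S.rho / S.R

/-- The factor `𝒜T/(ρ_l R̃)`. -/
def pfac (S : Equilibrium P) : ℝ := P.gasA * P.Tinf / (P.rhol * S.Rtil)

/-- The (unbounded) linear operator `ℒ`, given by its infinite matrix. -/
def linOp (S : Equilibrium P) (z : ℕ → ℝ) : ℕ → ℝ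
  | 0 => S.fac * ((∑' j, S.omg j * z (j + 3)) - z 2)
  | 1 => z 2
  | 2 => S.pfac * z 0
      + (2 * P.sig * S.Rbar ^ 4 + 2 * P.sigbar * S.R ^ 4)
          / (P.rhol * S.Rtil * S.R ^ 2 * S.Rbar ^ 4) * z 1
      - 4 * P.mul * S.Vbar / (P.rhol * S.Rtil * S.R * (S.R ^ 3 + S.Vbar)) * z 2
  | k + 3 => S.coef k * S.fac * (z 2 - ∑' j, S.omg j * z (j + 3)) - S.kbar * eigVal k * z (k + 3)

/-- The density `ρ† + ρ₂ + ρ₁(y)` of the state `z`. -/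
def dens (S : Equilibrium P) (z : ℕ → ℝ) (y : ℝ) : ℝ := S.rho + z 0 + rho1 z y

/-- The bubble radius `R† + ℛ` of the state `z`. -/
def rad (S : Equilibrium P) (z : ℕ → ℝ) : ℝ := S.R + z 1

/-- The exterior radius `(R³ + V̄)^{1/3}` of the state `z`. -/
def radBar (S : Equilibrium P) (z : ℕ → ℝ) : ℝ := BubbleParams.outer S.V (S.rad z)

/-- Physically meaningful states: positive radius and positive density up to the boundary. -/
def Admissible (S : Equilibrium P) (z : ℕ → ℝ) : Prop :=
  0 < S.rad z ∧ ∀ y ∈ Icc (0 : ℝ) 1, 0 < S.dens z y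

/-- `⟨Π¹(z), w⟩ = pi1 z y * w₀` at the radius `y`. -/
def pi1 (S : Equilibrium P) (z : ℕ → ℝ) (y : ℝ) : ℝ :=
  1 / (P.gam * (S.rho + z 0)) * (y / 3 * rho1' z y + rho1 z y)

/-- `⟨Φ¹(z), w⟩ = phi1 z * w₀`. -/
def phi1 (S : Equilibrium P) (z : ℕ → ℝ) : ℝ :=
  -(z 1 / (3 * P.gam * (S.rho + z 0))) + S.R * z 0 / (3 * P.gam * S.rho * (S.rho + z 0))

/-- `⟨Ψ¹(z), w⟩ = psi1 z * w₂`. -/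
def psi1 (S : Equilibrium P) (z : ℕ → ℝ) : ℝ :=
  P.rhol / (P.gasA * P.Tinf) * (z 1 + (S.R ^ 2 / S.Rbar - S.rad z ^ 2 / S.radBar z))

/-- `Π⁰_{k+1}(z) = ∫_{B₁} Π⁰(z) Ξ_{k+1}`, where
`Π⁰ = - κ/(γ c_v) |∇ρ₁|² / (R² ρ²) - κ/(γ c_v) [1/(R² ρ) - 1/(R†² ρ†)] ∑ λ_j θ_j Ξ_j`.
The last series converges in `L²(B₁)` and not pointwise absolutely, so it is integrated term by
term. -/
def pi0 (S : Equilibrium P) (z : ℕ → ℝ) (k : ℕ) : ℝ :=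
  -(P.kap / (P.gam * P.cv)) *
      ballInt (fun y => rho1' z y ^ 2 / (S.rad z ^ 2 * S.dens z y ^ 2) * eigFun k y)
    - P.kap / (P.gam * P.cv) * ∑' j, eigVal j * z (j + 3) *
      ballInt (fun y => (1 / (S.rad z ^ 2 * S.dens z y) - 1 / (S.R ^ 2 * S.rho))
        * eigFun j y * eigFun k y)

/-- `Φ⁰(z)`. -/
def phi0 (S : Equilibrium P) (z : ℕ → ℝ) : ℝ :=
  -(P.kap / (P.gam * P.cv)) *
    (1 / (S.rad z * (S.rho + z 0) ^ 2) - 1 / (S.R * S.rho ^ 2)) *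
    ∑' j : ℕ, Real.sqrt (Real.pi / 2) * (-1) ^ (j + 1) * ((j : ℝ) + 1) * z (j + 3)

/-- `Ψ⁰(z)`. -/
def psi0 (S : Equilibrium P) (z : ℕ → ℝ) : ℝ :=
  1 / (P.gasA * P.Tinf) *
    (4 * P.mul * S.Vbar *
        (1 / (S.rad z * (S.rad z ^ 3 + S.Vbar)) - 1 / (S.R * (S.R ^ 3 + S.Vbar))) * z 2
      + (2 * P.sig / S.R ^ 2 * z 1 + 2 * P.sig / S.rad z - 2 * P.sig / S.R)
      + (2 * P.sigbar * S.R ^ 2 / S.Rbar ^ 4 * z 1 + 2 * P.sigbar / S.radBar z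
          - 2 * P.sigbar / S.Rbar)
      + P.rhol * (3 / 2 - 2 * S.rad z / S.radBar z + S.rad z ^ 4 / (2 * S.radBar z ^ 4)) * z 2 ^ 2)

/-- The nonlinear term `𝒩¹(z) w`. -/
def nonlin1 (S : Equilibrium P) (z w : ℕ → ℝ) : ℕ → ℝ
  | 0 => S.fac * (S.phi1 z * w 0)
  | 1 => 0
  | 2 => -S.pfac * (S.psi1 z * w 2)
  | k + 3 => ballInt (fun y => S.pi1 z y * eigFun k y) * w 0
      - S.coef k * S.fac * (S.phi1 z * w 0)

/-- The nonlinear term `𝒩⁰(z)`. -/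
def nonlin0 (S : Equilibrium P) (z : ℕ → ℝ) : ℕ → ℝ
  | 0 => S.fac * S.phi0 z
  | 1 => 0
  | 2 => -S.pfac * S.psi0 z
  | k + 3 => S.pi0 z k - S.coef k * S.fac * S.phi0 z

/-- The right eigenvector `U` spanning the kernel of `ℒ`. -/
def vecU (S : Equilibrium P) : EllTwo := twoVec (-S.slope) 1

/-- The left eigenvector `Υ`. -/
def ups (S : Equilibrium P) : ℕ → ℝ
  | 0 => 4 * Real.pi / 3
  | 1 => 4 * Real.pi * S.rho / S.R
  | 2 => 0
  | k + 3 => P.gam * S.coef k / (P.gam - 1)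

/-- The normalized left eigenvector `Υ₀ = Υ / ⟨Υ, U⟩`. -/
def ups0 (S : Equilibrium P) (n : ℕ) : ℝ := (pairing S.ups S.vecU)⁻¹ * S.ups n

/-- The projection `𝒬₁ z = ⟨Υ₀, z⟩ U`. -/
def proj1 (S : Equilibrium P) (z : ℕ → ℝ) (n : ℕ) : ℝ := pairing S.ups0 z * S.vecU n

/-- The projection `𝒬₂ z = z - 𝒬₁ z`. -/
def proj2 (S : Equilibrium P) (z : ℕ → ℝ) (n : ℕ) : ℝ := z n - S.proj1 z n

/-- The one-dimensional subspace `X = span(U)` of `ℓ²`. -/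
abbrev spaceX (S : Equilibrium P) : Submodule ℝ EllTwo := Submodule.span ℝ {S.vecU}

/-- The vector `α U` of `X`. -/
def alphaU (S : Equilibrium P) (α : ℝ) : S.spaceX :=
  ⟨α • S.vecU, Submodule.smul_mem _ _ (Submodule.mem_span_singleton_self _)⟩

/-- `(x, y)` is a (strict) solution on `[0, T)` of the decomposed system
`ẋ = 𝒬₁(𝒩¹(x+y)[ẋ+ẏ]) + 𝒬₁ 𝒩⁰(x+y)`, `ẏ = ℒ y + 𝒬₂(𝒩¹(x+y)[ẋ+ẏ]) + 𝒬₂ 𝒩⁰(x+y)`: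
`x` takes values in `X`, both `x` and `y` are `C¹` into `ℓ²`, the state `z = x + y` is physically
meaningful, and `z` is continuous into the domain of `ℒ`, i.e. `(j² θ_j)_j` is a continuous curve in
`ℓ²`. -/
structure IsSolution (S : Equilibrium P) (T : ℝ) (x y : ℝ → EllTwo) : Prop where
  mem_X : ∀ t ∈ Ico 0 T, x t ∈ S.spaceX
  admissible : ∀ t ∈ Ico 0 T, S.Admissible (x t + y t)
  domain : ∃ v : ℝ → EllTwo, ContinuousOn v (Ico 0 T) ∧
    ∀ t ∈ Ico 0 T, ∀ j : ℕ, v t j = ((j : ℝ) + 1) ^ 2 * (x t + y t) (j + 3)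
  equation : ∃ x' y' : ℝ → EllTwo, ContinuousOn x' (Ico 0 T) ∧ ContinuousOn y' (Ico 0 T) ∧
    ∀ t ∈ Ico 0 T,
      HasDerivWithinAt x (x' t) (Ico 0 T) t ∧ HasDerivWithinAt y (y' t) (Ico 0 T) t ∧
      (∀ n, x' t n = S.proj1 (S.nonlin1 (x t + y t) (x' t + y' t)) n
        + S.proj1 (S.nonlin0 (x t + y t)) n) ∧
      (∀ n, y' t n = S.linOp (y t) n
        + S.proj2 (S.nonlin1 (x t + y t) (x' t + y' t)) n
        + S.proj2 (S.nonlin0 (x t + y t)) n)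

/-- The curve `y = h(x)`, defined on all of `X`, is a global center manifold of the decomposed
system: it is a `C¹` curve in `ℓ²` through the origin, its tangent line at the origin is `X`, and it
is invariant: through every point `(x₀, h(x₀))` there passes a solution for all times, and every
solution through `(x₀, h(x₀))` satisfies `y(t) = h(x(t))` as long as it exists. -/
structure IsGlobalCenterManifold (S : Equilibrium P) (h : S.spaceX → EllTwo) : Prop where
  contDiff : ContDiff ℝ 1 h
  zero : h 0 = 0
  tangent : LinearMap.range (fderiv ℝ h 0 : S.spaceX →ₗ[ℝ] EllTwo) = S.spaceX
  exists_solution : ∀ x₀ : S.spaceX, ∃ x y : ℝ → EllTwo, x 0 = x₀ ∧ y 0 = h x₀ ∧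
    ∀ T : ℝ, 0 < T → S.IsSolution T x y
  invariant : ∀ x₀ : S.spaceX, ∀ T : ℝ, 0 < T → ∀ x y : ℝ → EllTwo, S.IsSolution T x y →
    x 0 = x₀ → y 0 = h x₀ →
    ∀ t ∈ Ico 0 T, ∃ ht : x t ∈ S.spaceX, y t = h ⟨x t, ht⟩

/-- The relation between the position `x` and the velocity `v = ẋ` expressed by the equation on the
center manifold, `ẋ = 𝒬₁(𝒩¹(x+h(x))[ẋ+h'(x)ẋ]) + 𝒬₁ 𝒩⁰(x+h(x))`. -/
def ReducedEq (S : Equilibrium P) (h : S.spaceX → EllTwo) (x v : S.spaceX) : Prop :=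
  ∀ n, (v : EllTwo) n =
    S.proj1 (S.nonlin1 ((x : EllTwo) + h x) ((v : EllTwo) + fderiv ℝ h x v)) n
      + S.proj1 (S.nonlin0 ((x : EllTwo) + h x)) n

/-- `x` is a solution on `[0, T)` of the equation on the center manifold. -/
def IsReducedSolution (S : Equilibrium P) (h : S.spaceX → EllTwo) (T : ℝ) (x : ℝ → S.spaceX) :
    Prop :=
  ∀ t ∈ Ico 0 T, ∃ v : S.spaceX, HasDerivWithinAt x v (Ico 0 T) t ∧ S.ReducedEq h (x t) v

/-- Lyapunov stability of the zero solution of the equation on the center manifold: zero is a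
solution, and for every `ε > 0` there is `η > 0` such that from each initial value of norm below `η`
there starts a solution for all times, and every solution with such an initial value remains of norm
below `ε` as long as it exists. -/
def ReducedLyapunovStable (S : Equilibrium P) (h : S.spaceX → EllTwo) : Prop :=
  (∀ T : ℝ, 0 < T → S.IsReducedSolution h T (fun _ => 0)) ∧
  ∀ ε : ℝ, 0 < ε → ∃ η : ℝ, 0 < η ∧ ∀ x₀ : S.spaceX, ‖x₀‖ < η →
    (∃ x : ℝ → S.spaceX, x 0 = x₀ ∧ ∀ T : ℝ, 0 < T → S.IsReducedSolution h T x) ∧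
    ∀ T : ℝ, 0 < T → ∀ x : ℝ → S.spaceX, S.IsReducedSolution h T x → x 0 = x₀ →
      ∀ t ∈ Ico 0 T, ‖x t‖ < ε

/-- `ρ̂(α) = (2σ/R̂(α) + 2σ̄/(R̂(α)³ + V̄)^{1/3}) / (𝒜T)`. -/
def rhoHat (S : Equilibrium P) (Rhat : ℝ → ℝ) (α : ℝ) : ℝ :=
  1 / (P.gasA * P.Tinf) *
    (2 * P.sig / Rhat α + 2 * P.sigbar / (Rhat α ^ 3 + S.Vbar) ^ ((1 : ℝ) / 3))

/-- The vector
`h(αU) = (ρ̂(α) + (2σ/(𝒜T R†²) + 2σ̄R†²/(𝒜T R̄†⁴)) α - ρ†, R̂(α) - α - R†, 0, 0, …)`. -/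
def hVec (S : Equilibrium P) (Rhat : ℝ → ℝ) (α : ℝ) : EllTwo :=
  twoVec (S.rhoHat Rhat α + S.slope * α - S.rho) (Rhat α - α - S.R)

/-- The map `h : X → ℓ²`, `h(αU) = hVec α`. The coordinate `α` of `x = αU` is the entry of `x` with
index `1`, as that entry of `U` is `1`. -/
def hMap (S : Equilibrium P) (Rhat : ℝ → ℝ) (x : S.spaceX) : EllTwo :=
  S.hVec Rhat ((x : EllTwo) 1)

theorem alphaU_one (S : Equilibrium P) (α : ℝ) : (S.alphaU α : EllTwo) 1 = α := by
  change α * (twoVec (-S.slope) 1 : EllTwo) 1 = α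
  rw [twoVec_one, mul_one]

theorem hMap_alphaU (S : Equilibrium P) (Rhat : ℝ → ℝ) (α : ℝ) :
    S.hMap Rhat (S.alphaU α) = S.hVec Rhat α := by
  rw [hMap, alphaU_one]

end Equilibrium

end

noncomputable section

open MeasureTheory

/-! Adding the two equations of the decomposed system gives the full equation ż = ℒz + 𝒩(z, ż) for z
= x + y, because 𝒬₁ + 𝒬₂ = I and ℒ annihilates U. The point αU + h(αU) is the `staticState` of
radius R̂(α), an equilibrium of this equation. Hence every point of the curve is a constant
solution, and invariance reduces to a uniqueness statement, `eq_of_fullEq`: a solution that starts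
at a spherical equilibrium stays there. No general center manifold theorem enters.

Uniqueness is a Grönwall argument. Write q for the deviation of the boundary density, N for the
integral of ρ₁ over the ball, A = ∑ θ_k², w = ż and g = (γ - 1)/γ. The obstacle is w₀: it contains
the boundary flux ∂_yρ₁(1), which A does not control, and it drives every mode through c_k. Testing
the interior equation with ρ₁ leaves a dissipative term (`exists_hasSum_diffusion_nonpos`), a
multiple of A (`hasSum_transport`), and the bad term -g N w₀. For n = (4π/3) q + N the flux drops
out of ṅ, which is a bounded multiple of the radius velocity (`FullEq.mass`). Substituting N = n -
(4π/3) q, the bad term becomes the time derivative of g((2π/3) q² - q n) plus g q ṅ, so it can be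
moved into the energy; adding n² makes the result coercive (`energy_coercive`).

The mass balance `hasSum_mass` is a divergence theorem for a flux known only through its
coefficients. It is obtained by evaluating a cosine series at the endpoint y = 1.

For the reduced equation, 𝒩⁰ at a static state has only a velocity entry, where Υ vanishes. What
remains is α̇ = μ(α) α̇ with μ continuous and μ(0) = 0, so α̇ = 0 near the origin
(`exists_reducedEq_rigid`). Stability follows, since solutions that start near the origin are
constant. -/

theorem one_le_sqrt_two_pi : 1 ≤ Real.sqrt (2 * Real.pi) := by
  rw [Real.one_le_sqrt]
  linarith [Real.pi_gt_three]

theorem sqrt_two_pi_pos : 0 < Real.sqrt (2 * Real.pi) := lt_of_lt_of_le one_pos one_le_sqrt_two_pi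

/-! ### Radial Dirichlet eigenfunctions of the unit ball -/

/-- The wave number `(j+1)π` of the `j`-th eigenfunction. -/
def waveNum (j : ℕ) : ℝ := ((j : ℝ) + 1) * Real.pi

theorem waveNum_pos (j : ℕ) : 0 < waveNum j := by unfold waveNum; positivity

theorem eigFun_mul (j : ℕ) (y : ℝ) :
    y * eigFun j y = Real.sin (waveNum j * y) / Real.sqrt (2 * Real.pi) := by
  have hs := sqrt_two_pi_pos.ne'
  unfold eigFun waveNum
  rcases eq_or_ne y 0 with rfl | hy
  · simp
  · have hk : ((j : ℝ) + 1) * Real.pi * y ≠ 0 := by positivity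
    rw [Real.sinc_of_ne_zero hk]
    field_simp

theorem eigFun_eq (j : ℕ) {y : ℝ} (hy : y ≠ 0) :
    eigFun j y = Real.sin (waveNum j * y) / Real.sqrt (2 * Real.pi) / y := by
  rw [← eigFun_mul]; field_simp

theorem sin_waveNum (j : ℕ) : Real.sin (waveNum j) = 0 := by
  have := Real.sin_nat_mul_pi (j + 1)
  push_cast at this
  exact this

theorem cos_waveNum (j : ℕ) : Real.cos (waveNum j) = (-1) ^ (j + 1) := by
  have := Real.cos_nat_mul_pi (j + 1)
  push_cast at this
  exact this

theorem eigFun_one (j : ℕ) : eigFun j 1 = 0 := by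
  rw [eigFun_eq j one_ne_zero, mul_one, sin_waveNum]; simp

theorem continuous_eigFun (j : ℕ) : Continuous (eigFun j) := by
  unfold eigFun; fun_prop

/-- `y² Ξ_{j+1}'(y)`. -/
def eigFlux (j : ℕ) (y : ℝ) : ℝ :=
  (waveNum j * y * Real.cos (waveNum j * y) - Real.sin (waveNum j * y)) / Real.sqrt (2 * Real.pi)

theorem continuous_eigFlux (j : ℕ) : Continuous (eigFlux j) := by
  unfold eigFlux; fun_prop

theorem eigFlux_zero (j : ℕ) : eigFlux j 0 = 0 := by simp [eigFlux]

theorem hasDerivAt_eigFun (j : ℕ) {y : ℝ} (hy : y ≠ 0) :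
    HasDerivAt (eigFun j) (eigFlux j y / y ^ 2) y := by
  have h1 : HasDerivAt (fun y => Real.sin (waveNum j * y) / Real.sqrt (2 * Real.pi) / y)
      (eigFlux j y / y ^ 2) y := by
    have ha : HasDerivAt (fun y => waveNum j * y) (waveNum j) y := by
      simpa using (hasDerivAt_id y).const_mul (waveNum j)
    have := ((ha.sin).div_const (Real.sqrt (2 * Real.pi))).div (hasDerivAt_id y) hy
    refine this.congr_deriv ?_
    unfold eigFlux
    simp only [id]
    field_simp
  refine h1.congr_of_eventuallyEq ?_
  filter_upwards [isOpen_ne.mem_nhds hy] with x hx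
  exact eigFun_eq j hx

theorem deriv_eigFun (j : ℕ) {y : ℝ} (hy : y ≠ 0) : deriv (eigFun j) y = eigFlux j y / y ^ 2 :=
  (hasDerivAt_eigFun j hy).deriv

theorem sq_mul_deriv_eigFun (j : ℕ) {y : ℝ} (hy : y ≠ 0) :
    y ^ 2 * deriv (eigFun j) y = eigFlux j y := by
  rw [deriv_eigFun j hy]; field_simp

/-- Divergence form of -ΔΞ = λΞ. Passing to the flux y²Ξ' removes the singularity at the origin, so
no exception at y = 0 is needed when Green's formula is derived. -/
theorem hasDerivAt_eigFlux (j : ℕ) (y : ℝ) :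
    HasDerivAt (eigFlux j) (-(eigVal j * (y ^ 2 * eigFun j y))) y := by
  have ha : HasDerivAt (fun y => waveNum j * y) (waveNum j) y := by
    simpa using (hasDerivAt_id y).const_mul (waveNum j)
  have := ((ha.mul ha.cos).sub ha.sin).div_const (Real.sqrt (2 * Real.pi))
  refine this.congr_deriv ?_
  rw [pow_two, mul_assoc y, eigFun_mul]
  have : eigVal j = waveNum j ^ 2 := rfl
  rw [this]
  ring

/-- The expression is O(x²) near 0 and O(x) for large x, and the power 5/4 lies in between. Later
uses need an exponent s with 1 < s < 3/2: the first inequality makes y^(s-2) integrable at the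
origin, the second makes j^(s-2) square summable. -/
theorem abs_mul_cos_sub_sin_le {x : ℝ} (hx : 0 ≤ x) :
    |x * Real.cos x - Real.sin x| ≤ 2 * x ^ (5 / 4 : ℝ) := by
  have h2 : |x * Real.cos x - Real.sin x| ≤ 2 * x := by
    have h3 : |Real.sin x| ≤ x := by simpa [abs_of_nonneg hx] using (Real.abs_sin_le_abs (x := x))
    calc |x * Real.cos x - Real.sin x| ≤ |x * Real.cos x| + |Real.sin x| := abs_sub _ _
      _ ≤ x * 1 + x := by
        rw [abs_mul, abs_of_nonneg hx]
        gcongr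
        exact Real.abs_cos_le_one x
      _ = 2 * x := by ring
  rcases le_total x 1 with h | h
  · have h1 : |x * Real.cos x - Real.sin x| ≤ x * x := by
      have hd : ∀ u ∈ Icc 0 x, HasDerivWithinAt (fun u => u * Real.cos u - Real.sin u)
          (-(u * Real.sin u)) (Icc 0 x) u := by
        intro u _
        have := ((hasDerivAt_id u).mul (Real.hasDerivAt_cos u)).sub (Real.hasDerivAt_sin u)
        refine (this.congr_deriv ?_).hasDerivWithinAt
        simp only [id]; ring
      have hb : ∀ u ∈ Icc 0 x, ‖-(u * Real.sin u)‖ ≤ x := by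
        intro u hu
        rw [norm_neg, Real.norm_eq_abs, abs_mul, abs_of_nonneg hu.1]
        nlinarith [Real.abs_sin_le_one u, hu.1, hu.2, abs_nonneg (Real.sin u)]
      have := (convex_Icc (0 : ℝ) x).norm_image_sub_le_of_norm_hasDerivWithin_le hd hb
        (left_mem_Icc.2 hx) (right_mem_Icc.2 hx)
      simpa [abs_of_nonneg hx] using this
    have h4 : x ^ (2 : ℝ) ≤ x ^ (5 / 4 : ℝ) := by
      rcases hx.eq_or_lt with rfl | hx'
      · rw [Real.zero_rpow (by norm_num), Real.zero_rpow (by norm_num)]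
      · exact Real.rpow_le_rpow_of_exponent_ge hx' h (by norm_num)
    rw [Real.rpow_two] at h4
    nlinarith [Real.rpow_nonneg hx (5 / 4 : ℝ)]
  · have h4 : x ^ (1 : ℝ) ≤ x ^ (5 / 4 : ℝ) := Real.rpow_le_rpow_of_exponent_le h (by norm_num)
    rw [Real.rpow_one] at h4
    linarith

/-- The weight `(j+1)^{5/4}` dominating the `j`-th eigenfunction and its derivative. -/
def modeWeight (j : ℕ) : ℝ := ((j : ℝ) + 1) ^ (5 / 4 : ℝ)

theorem modeWeight_nonneg (j : ℕ) : 0 ≤ modeWeight j := by unfold modeWeight; positivity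

theorem le_modeWeight (j : ℕ) : (j : ℝ) + 1 ≤ modeWeight j := by
  unfold modeWeight
  have : ((j : ℝ) + 1) ^ (1 : ℝ) ≤ ((j : ℝ) + 1) ^ (5 / 4 : ℝ) :=
    Real.rpow_le_rpow_of_exponent_le (by linarith [Nat.cast_nonneg (α := ℝ) j]) (by norm_num)
  simpa using this

theorem abs_eigFun_le (j : ℕ) (y : ℝ) : |eigFun j y| ≤ 32 * modeWeight j := by
  unfold eigFun
  rw [abs_mul]
  have h1 := Real.abs_sinc_le_one (((j : ℝ) + 1) * Real.pi * y)
  have h2 : |((j : ℝ) + 1) * Real.pi / Real.sqrt (2 * Real.pi)| ≤ 32 * modeWeight j := by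
    rw [abs_of_nonneg (by positivity), div_le_iff₀ sqrt_two_pi_pos]
    nlinarith [Real.pi_lt_four, Real.pi_pos, le_modeWeight j, one_le_sqrt_two_pi,
      modeWeight_nonneg j, mul_nonneg (modeWeight_nonneg j) (sub_nonneg.2 one_le_sqrt_two_pi),
      Nat.cast_nonneg (α := ℝ) j,
      mul_nonneg (modeWeight_nonneg j) (sub_nonneg.2 Real.pi_lt_four.le)]
  exact (mul_le_of_le_one_right (abs_nonneg _) h1).trans h2

theorem abs_eigFlux_le (j : ℕ) {y : ℝ} (hy : 0 ≤ y) :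
    |eigFlux j y| ≤ 32 * modeWeight j * y ^ (5 / 4 : ℝ) := by
  unfold eigFlux
  rw [abs_div, abs_of_pos sqrt_two_pi_pos]
  have h1 := abs_mul_cos_sub_sin_le (x := waveNum j * y)
    (mul_nonneg (waveNum_pos j).le hy)
  have h2 : (waveNum j * y) ^ (5 / 4 : ℝ) ≤ 16 * modeWeight j * y ^ (5 / 4 : ℝ) := by
    unfold waveNum modeWeight
    rw [Real.mul_rpow (by positivity) hy, Real.mul_rpow (by positivity) Real.pi_pos.le]
    have h3 : Real.pi ^ (5 / 4 : ℝ) ≤ 16 := by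
      calc Real.pi ^ (5 / 4 : ℝ) ≤ Real.pi ^ (2 : ℝ) :=
            Real.rpow_le_rpow_of_exponent_le (by linarith [Real.pi_gt_three]) (by norm_num)
        _ ≤ 16 := by
          rw [Real.rpow_two]; nlinarith [Real.pi_lt_four, Real.pi_pos]
    rw [mul_comm (16 : ℝ)]
    gcongr
  calc _ ≤ |waveNum j * y * Real.cos (waveNum j * y) - Real.sin (waveNum j * y)| :=
        div_le_self (abs_nonneg _) one_le_sqrt_two_pi
    _ ≤ _ := by linarith

theorem rpow_div_sq {y : ℝ} (hy : 0 < y) : y ^ (5 / 4 : ℝ) / y ^ 2 = y ^ (-3 / 4 : ℝ) := by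
  rw [← Real.rpow_natCast, ← Real.rpow_sub hy]; norm_num

theorem abs_deriv_eigFun_le (j : ℕ) {y : ℝ} (hy : 0 < y) :
    |deriv (eigFun j) y| ≤ 32 * modeWeight j * y ^ (-3 / 4 : ℝ) := by
  rw [deriv_eigFun j hy.ne', abs_div, abs_of_pos (pow_pos hy 2), ← rpow_div_sq hy, ← mul_div_assoc]
  gcongr
  exact abs_eigFlux_le j hy.le

theorem continuousOn_deriv_eigFun (j : ℕ) : ContinuousOn (deriv (eigFun j)) (Ioi 0) := by
  refine ContinuousOn.congr (f := fun y => eigFlux j y / y ^ 2) ?_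
    fun y hy => deriv_eigFun j (ne_of_gt hy)
  exact (continuous_eigFlux j).continuousOn.div (by fun_prop)
    fun y hy => pow_ne_zero 2 (ne_of_gt hy)

theorem deriv_eigFun_one (j : ℕ) :
    deriv (eigFun j) 1 = Real.sqrt (Real.pi / 2) * (-1) ^ (j + 1) * ((j : ℝ) + 1) := by
  rw [deriv_eigFun j one_ne_zero]
  unfold eigFlux
  rw [mul_one, sin_waveNum, cos_waveNum]
  have h : Real.sqrt (Real.pi / 2) * Real.sqrt (2 * Real.pi) = Real.pi := by
    rw [← Real.sqrt_mul (by positivity), show Real.pi / 2 * (2 * Real.pi) = Real.pi ^ 2 by ring,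
      Real.sqrt_sq Real.pi_pos.le]
  have hs := sqrt_two_pi_pos.ne'
  rw [sub_zero, one_pow, div_one, div_eq_iff hs]
  unfold waveNum
  linear_combination (-((-1) ^ (j + 1) * ((j : ℝ) + 1))) * h

/-- Orthonormality of the radial Dirichlet eigenfunctions. -/
theorem ballInt_eigFun_mul (j k : ℕ) :
    4 * Real.pi * ∫ y in (0 : ℝ)..1, y ^ 2 * (eigFun j y * eigFun k y) = if j = k then 1 else 0 := by
  have hs : Real.sqrt (2 * Real.pi) ^ 2 = 2 * Real.pi := Real.sq_sqrt (by positivity)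
  have h1 : ∀ y : ℝ, y ^ 2 * (eigFun j y * eigFun k y) = (1 / (4 * Real.pi)) *
      (Real.cos ((waveNum j - waveNum k) * y) - Real.cos ((waveNum j + waveNum k) * y)) := by
    intro y
    have : y ^ 2 * (eigFun j y * eigFun k y) = (y * eigFun j y) * (y * eigFun k y) := by ring
    rw [this, eigFun_mul, eigFun_mul, div_mul_div_comm, ← pow_two (Real.sqrt _), hs,
      sub_mul, add_mul, Real.cos_sub, Real.cos_add]
    have := Real.pi_pos.ne'
    field_simp
    ring
  have hint : ∀ n : ℤ, n ≠ 0 → ∫ y in (0 : ℝ)..1, Real.cos ((n * Real.pi) * y) = 0 := by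
    intro n hn
    have hc : (n * Real.pi : ℝ) ≠ 0 := mul_ne_zero (Int.cast_ne_zero.2 hn) Real.pi_pos.ne'
    rw [intervalIntegral.integral_comp_mul_left (fun x => Real.cos x) hc, integral_cos]
    simp [Real.sin_int_mul_pi]
  have e2 : waveNum j + waveNum k = ((j + k + 2 : ℤ) : ℝ) * Real.pi := by
    unfold waveNum; push_cast; ring
  have e1 : waveNum j - waveNum k = ((j - k : ℤ) : ℝ) * Real.pi := by
    unfold waveNum; push_cast; ring
  simp_rw [h1]
  rw [intervalIntegral.integral_const_mul, intervalIntegral.integral_sub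
    (Continuous.intervalIntegrable (by fun_prop) _ _) (Continuous.intervalIntegrable (by fun_prop) _ _),
    e2, hint _ (by omega)]
  have := Real.pi_pos.ne'
  split_ifs with h
  · subst h
    simp
    field_simp
  · rw [e1, hint _ (by omega)]; simp

/-! ### Series of the interior density and its derivative -/

/-- The summability condition on the coefficients of the interior density that makes `rho1`
continuously differentiable away from the origin. -/
def ModeSummable (z : ℕ → ℝ) : Prop := Summable fun j => |z (j + 3)| * modeWeight j

/-- Since (j+1)^(5/4) = (j+1)² (j+1)^(-3/4) and (j+1)^(-3/4) is square summable, the product of two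
square summable sequences is dominated by the sum of their squares. This is how the domain condition
on ℒ is used. -/
theorem modeSummable_of_sq {z : ℕ → ℝ}
    (h : Summable fun j : ℕ => (((j : ℝ) + 1) ^ 2 * z (j + 3)) ^ 2) : ModeSummable z := by
  have h2 : Summable fun j : ℕ => ((j : ℝ) + 1) ^ (-3 / 2 : ℝ) := by
    have h3 : Summable fun j : ℕ => (j : ℝ) ^ (-3 / 2 : ℝ) :=
      Real.summable_nat_rpow.2 (by norm_num)
    simpa using (summable_nat_add_iff 1).2 h3
  refine Summable.of_nonneg_of_le (fun j => mul_nonneg (abs_nonneg _) (modeWeight_nonneg j))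
    (fun j => ?_) (h.add h2)
  have hk : (0 : ℝ) < (j : ℝ) + 1 := by positivity
  have e : ((j : ℝ) + 1) ^ (5 / 4 : ℝ) = ((j : ℝ) + 1) ^ 2 * ((j : ℝ) + 1) ^ (-3 / 4 : ℝ) := by
    rw [← Real.rpow_natCast, ← Real.rpow_add hk]; norm_num
  have e2 : ((j : ℝ) + 1) ^ (-3 / 2 : ℝ) = (((j : ℝ) + 1) ^ (-3 / 4 : ℝ)) ^ 2 := by
    rw [← Real.rpow_natCast, ← Real.rpow_mul hk.le]; norm_num
  unfold modeWeight
  rw [e, e2, ← sq_abs (((j : ℝ) + 1) ^ 2 * z (j + 3)), abs_mul, abs_of_pos (pow_pos hk 2)]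
  nlinarith [sq_nonneg (((j : ℝ) + 1) ^ 2 * |z (j + 3)| - ((j : ℝ) + 1) ^ (-3 / 4 : ℝ)),
    sq_nonneg (((j : ℝ) + 1) ^ 2 * |z (j + 3)|), sq_nonneg (((j : ℝ) + 1) ^ (-3 / 4 : ℝ))]

namespace ModeSummable

variable {z : ℕ → ℝ}

/-- The weighted `ℓ¹` norm of the coefficients of the interior density. -/
def bound (z : ℕ → ℝ) : ℝ := 32 * ∑' j, |z (j + 3)| * modeWeight j

theorem summable_bound (hz : ModeSummable z) :
    Summable fun j => 32 * (|z (j + 3)| * modeWeight j) := hz.mul_left 32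

theorem norm_term_le (j : ℕ) (y : ℝ) :
    ‖z (j + 3) * eigFun j y‖ ≤ 32 * (|z (j + 3)| * modeWeight j) := by
  rw [norm_mul, Real.norm_eq_abs, Real.norm_eq_abs]
  calc _ ≤ |z (j + 3)| * (32 * modeWeight j) := by
        gcongr; exact abs_eigFun_le j y
    _ = _ := by ring

theorem norm_deriv_term_le (j : ℕ) {y : ℝ} (hy : 0 < y) :
    ‖z (j + 3) * deriv (eigFun j) y‖ ≤
      32 * (|z (j + 3)| * modeWeight j) * y ^ (-3 / 4 : ℝ) := by
  rw [norm_mul, Real.norm_eq_abs, Real.norm_eq_abs]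
  calc _ ≤ |z (j + 3)| * (32 * modeWeight j * y ^ (-3 / 4 : ℝ)) := by
        gcongr; exact abs_deriv_eigFun_le j hy
    _ = _ := by ring

theorem hasSum_rho1 (hz : ModeSummable z) (y : ℝ) :
    HasSum (fun j => z (j + 3) * eigFun j y) (rho1 z y) :=
  (Summable.of_norm_bounded hz.summable_bound fun j => norm_term_le j y).hasSum

theorem hasSum_rho1' (hz : ModeSummable z) {y : ℝ} (hy : 0 < y) :
    HasSum (fun j => z (j + 3) * deriv (eigFun j) y) (rho1' z y) :=
  (Summable.of_norm_bounded (hz.summable_bound.mul_right _) fun j => norm_deriv_term_le j hy).hasSum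

theorem abs_rho1'_le (hz : ModeSummable z) {y : ℝ} (hy : 0 < y) :
    |rho1' z y| ≤ bound z * y ^ (-3 / 4 : ℝ) := by
  have := tsum_of_norm_bounded (hz.summable_bound.hasSum.mul_right (y ^ (-3 / 4 : ℝ)))
    fun j => norm_deriv_term_le (z := z) j hy
  rw [tsum_mul_left] at this
  exact this

theorem continuous_rho1 (hz : ModeSummable z) : Continuous (rho1 z) :=
  continuous_tsum (fun j => (continuous_eigFun j).const_mul _) hz.summable_bound
    fun j y => norm_term_le j y

theorem norm_deriv_term_le_of_le (j : ℕ) {x y : ℝ} (hx : 0 < x) (hy : x ≤ y) :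
    ‖z (j + 3) * deriv (eigFun j) y‖ ≤
      32 * (|z (j + 3)| * modeWeight j) * x ^ (-3 / 4 : ℝ) :=
  (norm_deriv_term_le j (hx.trans_le hy)).trans <| by
    refine mul_le_mul_of_nonneg_left
      (Real.rpow_le_rpow_of_nonpos hx hy (by norm_num)) ?_
    have := modeWeight_nonneg j
    positivity

theorem continuousOn_rho1' (hz : ModeSummable z) : ContinuousOn (rho1' z) (Ioi 0) := by
  intro y hy
  have hy' : (0 : ℝ) < y := hy
  have : ContinuousOn (rho1' z) (Ioi (y / 2)) := by
    refine continuousOn_tsum (fun j => ?_) (hz.summable_bound.mul_right ((y / 2) ^ (-3 / 4 : ℝ)))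
      fun j x hx => norm_deriv_term_le_of_le j (half_pos hy') (le_of_lt hx)
    exact ((continuousOn_deriv_eigFun j).mono (Ioi_subset_Ioi (half_pos hy').le)).const_mul _
  exact (this.continuousAt (Ioi_mem_nhds (half_lt_self hy'))).continuousWithinAt

theorem hasDerivAt_rho1 (hz : ModeSummable z) {y : ℝ} (hy : 0 < y) :
    HasDerivAt (rho1 z) (rho1' z y) y :=
  hasDerivAt_tsum_of_isPreconnected (t := Ioi (y / 2))
    (hz.summable_bound.mul_right ((y / 2) ^ (-3 / 4 : ℝ))) isOpen_Ioi isPreconnected_Ioi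
    (fun j _ hx => ((hasDerivAt_eigFun j
      (ne_of_gt ((half_pos hy).trans hx))).differentiableAt.hasDerivAt.const_mul _))
    (fun j _ hx => norm_deriv_term_le_of_le j (half_pos hy) (le_of_lt hx))
    (mem_Ioi.2 (half_lt_self hy)) (hz.hasSum_rho1 y).summable (mem_Ioi.2 (half_lt_self hy))

end ModeSummable

theorem rho1_one (z : ℕ → ℝ) : rho1 z 1 = 0 := by simp [rho1, eigFun_one]

/-! ### Fourier series at the endpoint -/

/-- The cosine series of a continuous function on `[0, 1]` with absolutely summable coefficients,
evaluated at the endpoint `1`. -/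
theorem hasSum_cos_coeff_endpoint {W : ℝ → ℝ} (hW : ContinuousOn W (Icc 0 1))
    (hs : Summable fun j : ℕ => ∫ y in (0 : ℝ)..1, W y * Real.cos (waveNum j * y)) :
    HasSum (fun j : ℕ => 2 * (-1) ^ (j + 1) * ∫ y in (0 : ℝ)..1, W y * Real.cos (waveNum j * y))
      (W 1 - ∫ y in (0 : ℝ)..1, W y) := by
  have : Fact ((0 : ℝ) < 2) := ⟨two_pos⟩
  set f : ℝ → ℂ := fun x => (W |x| : ℂ) with hf
  have hfc : ContinuousOn f (Icc (-1) (-1 + 2)) := by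
    refine Complex.continuous_ofReal.comp_continuousOn (hW.comp continuous_abs.continuousOn ?_)
    intro x hx
    exact ⟨abs_nonneg x, abs_le.2 ⟨hx.1, by linarith [hx.2]⟩⟩
  have hfe : f (-1) = f (-1 + 2) := by simp only [hf]; norm_num
  -- The even extension of W has period 2 and is continuous on the circle. Its Fourier coefficients
  -- are the cosine integrals of W, and the point -1 stands for the endpoint 1.
  let F : C(AddCircle (2 : ℝ), ℂ) := ⟨AddCircle.liftIco 2 (-1) f, AddCircle.liftIco_continuous hfe hfc⟩
  set c : ℤ → ℝ := fun n => ∫ y in (0 : ℝ)..1, W y * Real.cos (n * Real.pi * y) with hc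
  have hcoeff : ∀ n : ℤ, fourierCoeff F n = (c n : ℂ) := by
    intro n
    change fourierCoeff (AddCircle.liftIco 2 (-1) f) n = _
    rw [fourierCoeff_liftIco_eq, fourierCoeffOn_eq_integral]
    have e1 : ∀ x : ℝ, (fourier (-n) (x : AddCircle (-1 + 2 - (-1) : ℝ)) : ℂ) • f x
        = Complex.exp (-(n * Real.pi * x : ℝ) * Complex.I) * f x := by
      intro x
      rw [fourier_coe_apply, smul_eq_mul]
      congr 2
      push_cast
      ring
    simp_rw [e1]
    have hg : ContinuousOn (fun x : ℝ => Complex.exp (-(n * Real.pi * x : ℝ) * Complex.I) * f x)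
        (Icc (-1) 1) := by
      refine ContinuousOn.mul (by fun_prop) ?_
      convert hfc using 2
      norm_num
    have i1 : IntervalIntegrable (fun x : ℝ => Complex.exp (-(n * Real.pi * x : ℝ) * Complex.I) * f x)
        volume (-1) 0 := by
      refine ContinuousOn.intervalIntegrable (hg.mono ?_)
      rw [uIcc_of_le (by norm_num)]
      exact Icc_subset_Icc le_rfl (by norm_num)
    have i2 : IntervalIntegrable (fun x : ℝ => Complex.exp (-(n * Real.pi * x : ℝ) * Complex.I) * f x)
        volume 0 1 := by
      refine ContinuousOn.intervalIntegrable (hg.mono ?_)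
      rw [uIcc_of_le (by norm_num)]
      exact Icc_subset_Icc (by norm_num) le_rfl
    have i3 : IntervalIntegrable (fun x : ℝ => Complex.exp (-(n * Real.pi * (-x) : ℝ) * Complex.I)
        * f (-x)) volume 0 1 := by
      simpa using (i1.comp_sub_left 0).symm
    have e2 : (∫ x in (-1 : ℝ)..0, Complex.exp (-(n * Real.pi * x : ℝ) * Complex.I) * f x)
        = ∫ x in (0 : ℝ)..1, Complex.exp (-(n * Real.pi * (-x) : ℝ) * Complex.I) * f (-x) := by
      have := intervalIntegral.integral_comp_neg (a := 0) (b := 1)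
        (fun x : ℝ => Complex.exp (-(n * Real.pi * x : ℝ) * Complex.I) * f x)
      rw [this]; norm_num
    have e3 : (∫ x in (-1 : ℝ)..(-1 + 2), Complex.exp (-(n * Real.pi * x : ℝ) * Complex.I) * f x)
        = 2 * (c n : ℂ) := by
      rw [show (-1 + 2 : ℝ) = 1 by norm_num, ← intervalIntegral.integral_add_adjacent_intervals i1 i2,
        e2, ← intervalIntegral.integral_add i3 i2, hc, ← intervalIntegral.integral_ofReal,
        ← intervalIntegral.integral_const_mul]
      refine intervalIntegral.integral_congr fun x hx => ?_
      rw [uIcc_of_le zero_le_one] at hx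
      simp only [hf, abs_neg, abs_of_nonneg hx.1]
      push_cast
      rw [Complex.cos]
      ring_nf
    rw [e3, show (-1 + 2 - -1 : ℝ) = 2 by norm_num, Complex.real_smul]
    push_cast
    ring
  have hsucc : ∀ j : ℕ, c ((j : ℤ) + 1) = ∫ y in (0 : ℝ)..1, W y * Real.cos (waveNum j * y) := by
    intro j; simp only [hc, waveNum]; push_cast; rfl
  have hneg : ∀ n : ℤ, c (-n) = c n := by
    intro n
    simp only [hc]
    refine intervalIntegral.integral_congr fun x _ => ?_
    simp only [Int.cast_neg, neg_mul, Real.cos_neg]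
  have hsn : Summable fun n : ℕ => c n := by
    refine (summable_nat_add_iff 1).1 ?_
    simpa only [Nat.cast_add, Nat.cast_one, hsucc] using hs
  have hsz : Summable c := Summable.of_nat_of_neg hsn (by simpa only [hneg] using hsn)
  have hsF : Summable (fourierCoeff F) := by
    have : fourierCoeff F = fun n => (c n : ℂ) := funext hcoeff
    rw [this]
    exact Complex.ofRealCLM.summable hsz
  have hsum := has_pointwise_sum_fourier_series_of_summable hsF ((-1 : ℝ) : AddCircle (2 : ℝ))
  have hF1 : F ((-1 : ℝ) : AddCircle (2 : ℝ)) = (W 1 : ℂ) := by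
    change AddCircle.liftIco 2 (-1) f _ = _
    rw [AddCircle.liftIco_coe_apply (by norm_num)]
    simp [hf]
  have hterm : ∀ n : ℤ, fourierCoeff F n • (fourier n ((-1 : ℝ) : AddCircle (2 : ℝ)) : ℂ)
      = ((c n * (-1) ^ n.natAbs : ℝ) : ℂ) := by
    intro n
    rw [hcoeff, fourier_coe_apply]
    have : 2 * (Real.pi : ℂ) * Complex.I * n * ((-1 : ℝ) : ℂ) / ((2 : ℝ) : ℂ)
        = (-n : ℤ) * (Real.pi * Complex.I) := by push_cast; ring
    rw [this, Complex.exp_int_mul, Complex.exp_pi_mul_I, smul_eq_mul]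
    push_cast
    congr 1
    rcases Int.eq_nat_or_neg n with ⟨m, rfl | rfl⟩ <;> simp [zpow_neg, ← inv_pow, inv_neg]
  rw [hF1] at hsum
  simp_rw [hterm] at hsum
  have hsumR : HasSum (fun n : ℤ => c n * (-1) ^ n.natAbs) (W 1) := by
    exact_mod_cast hsum
  have h2 := hsumR.nat_add_neg
  -- Folding n with -n counts the term n = 0 twice, and removing it leaves W(1) + c(0) - 2c(0).
  have h3 := (hasSum_nat_add_iff' 1).2 h2
  have hc0 : c 0 = ∫ y in (0 : ℝ)..1, W y := by simp [hc]
  convert! h3 using 1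
  · funext j
    rw [hneg, Int.natAbs_neg, ← hsucc]
    push_cast
    have : ((j : ℤ) + 1).natAbs = j + 1 := by omega
    rw [this]
    ring
  · simp [hc0]

/-- If `τ_j` is the sine coefficient of `η + β'` in weak form and `τ` is square summable, then the
pairing of `τ` with the sine coefficients of `y ↦ y` picks up the boundary value of `β`. -/
theorem hasSum_sine_coeff_pairing {β η : ℝ → ℝ} (hβ : ContinuousOn β (Icc 0 1))
    (hη : IntervalIntegrable η volume 0 1) (hηc : ContinuousOn η (Ioo 0 1)) {τ : ℕ → ℝ}
    (hτ : Summable fun j => τ j ^ 2)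
    (h : ∀ j, τ j = (∫ y in (0 : ℝ)..1, η y * Real.sin (waveNum j * y))
      - waveNum j * ∫ y in (0 : ℝ)..1, β y * Real.cos (waveNum j * y)) :
    HasSum (fun j : ℕ => 2 * (-1) ^ j / waveNum j * τ j)
      (β 1 - (∫ y in (0 : ℝ)..1, β y) + ∫ y in (0 : ℝ)..1, y * η y) := by
  have h01 : uIcc (0 : ℝ) 1 = Icc 0 1 := uIcc_of_le zero_le_one
  -- With u the primitive of η, both η and β' are absorbed into the derivative of W = β + u, so that
  -- τ_j is minus the wave number times the cosine coefficient of W.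
  set u : ℝ → ℝ := fun y => ∫ s in (0 : ℝ)..y, η s with hu
  have huc : ContinuousOn u (Icc 0 1) := by
    rw [← h01]
    exact intervalIntegral.continuousOn_primitive_interval' hη left_mem_uIcc
  have hud : ∀ y ∈ Ioo (0 : ℝ) 1, HasDerivAt u (η y) y := by
    intro y hy
    refine intervalIntegral.integral_hasDerivAt_right
      (hη.mono_set (uIcc_subset_uIcc_left (by rw [h01]; exact Ioo_subset_Icc_self hy))) ?_
      (hηc.continuousAt (Ioo_mem_nhds hy.1 hy.2))
    exact hηc.stronglyMeasurableAtFilter isOpen_Ioo y hy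
  have hu0 : u 0 = 0 := by simp [hu]
  have hui : IntervalIntegrable u volume 0 1 := (h01 ▸ huc).intervalIntegrable
  have hβi : IntervalIntegrable β volume 0 1 := (h01 ▸ hβ).intervalIntegrable
  have hparts : ∀ j, (∫ y in (0 : ℝ)..1, η y * Real.sin (waveNum j * y))
      = - (waveNum j * ∫ y in (0 : ℝ)..1, u y * Real.cos (waveNum j * y)) := by
    intro j
    have i1 : IntervalIntegrable (fun y => η y * Real.sin (waveNum j * y)) volume 0 1 :=
      hη.mul_continuousOn (by fun_prop)
    have i2 : IntervalIntegrable (fun y => waveNum j * (u y * Real.cos (waveNum j * y))) volume 0 1 :=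
      (hui.mul_continuousOn (by fun_prop)).const_mul _
    have hF := intervalIntegral.integral_eq_sub_of_hasDerivAt_of_le (a := (0 : ℝ)) (b := 1)
      zero_le_one (f := fun y => u y * Real.sin (waveNum j * y))
      (f' := fun y => η y * Real.sin (waveNum j * y) + waveNum j * (u y * Real.cos (waveNum j * y)))
      (huc.mul (by fun_prop)) (fun y hy => by
        have ha : HasDerivAt (fun y => waveNum j * y) (waveNum j) y := by
          simpa using (hasDerivAt_id y).const_mul (waveNum j)
        refine ((hud y hy).mul ha.sin).congr_deriv ?_
        ring) (i1.add i2)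
    rw [intervalIntegral.integral_add i1 i2, intervalIntegral.integral_const_mul] at hF
    simp only [mul_one, mul_zero, sin_waveNum, hu0] at hF
    linarith
  set W : ℝ → ℝ := fun y => β y + u y with hWdef
  have hW : ContinuousOn W (Icc 0 1) := hβ.add huc
  have hcoef : ∀ j, (∫ y in (0 : ℝ)..1, W y * Real.cos (waveNum j * y)) = - (τ j / waveNum j) := by
    intro j
    have i1 : IntervalIntegrable (fun y => β y * Real.cos (waveNum j * y)) volume 0 1 :=
      hβi.mul_continuousOn (by fun_prop)
    have i2 : IntervalIntegrable (fun y => u y * Real.cos (waveNum j * y)) volume 0 1 :=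
      hui.mul_continuousOn (by fun_prop)
    have hw := (waveNum_pos j).ne'
    simp only [hWdef, add_mul]
    rw [intervalIntegral.integral_add i1 i2, h j, hparts j]
    field_simp
    ring
  have hinv : Summable fun j => (1 / waveNum j) ^ 2 := by
    have h1 : Summable fun j : ℕ => 1 / (j : ℝ) ^ 2 :=
      Real.summable_one_div_nat_pow.2 (by norm_num)
    have h2 := ((summable_nat_add_iff 1).2 h1).mul_left (1 / Real.pi ^ 2)
    refine h2.congr fun j => ?_
    unfold waveNum
    push_cast
    field_simp
  -- The cosine coefficients are products of the square summable sequences τ_j and 1/waveNum j,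
  -- hence absolutely summable. This is the only use of the hypothesis on τ.
  have hsum : Summable fun j => ∫ y in (0 : ℝ)..1, W y * Real.cos (waveNum j * y) := by
    refine Summable.of_norm_bounded (hτ.add hinv) fun j => ?_
    rw [hcoef, norm_neg, Real.norm_eq_abs, div_eq_mul_one_div, abs_mul,
      ← sq_abs (τ j), ← sq_abs (1 / waveNum j)]
    nlinarith [sq_nonneg (|τ j| - |1 / waveNum j|), sq_nonneg (|τ j|), sq_nonneg (|1 / waveNum j|)]
  have key := hasSum_cos_coeff_endpoint hW hsum
  -- The value u(1) occurring here cancels against the one in W(1).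
  have hyu : (∫ y in (0 : ℝ)..1, u y) = u 1 - ∫ y in (0 : ℝ)..1, y * η y := by
    have i1 : IntervalIntegrable (fun y => y * η y) volume 0 1 :=
      hη.continuousOn_mul (by fun_prop)
    have hF := intervalIntegral.integral_eq_sub_of_hasDerivAt_of_le (a := (0 : ℝ)) (b := 1)
      zero_le_one (f := fun y => y * u y) (f' := fun y => u y + y * η y)
      (continuousOn_id.mul huc) (fun y hy => by
        refine ((hasDerivAt_id y).mul (hud y hy)).congr_deriv ?_
        simp) (hui.add i1)
    rw [intervalIntegral.integral_add hui i1] at hF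
    linarith
  have hval : W 1 - (∫ y in (0 : ℝ)..1, W y)
      = β 1 - (∫ y in (0 : ℝ)..1, β y) + ∫ y in (0 : ℝ)..1, y * η y := by
    simp only [hWdef]
    rw [intervalIntegral.integral_add hβi hui, hyu]
    ring
  rw [hval] at key
  convert! key using 2 with j
  rw [hcoef]
  ring

/-! ### Green's formula and integral identities for the interior density -/

theorem ContinuousOn.intervalIntegrable_zero_one {g : ℝ → ℝ} (hg : ContinuousOn g (Icc 0 1)) :
    IntervalIntegrable g volume 0 1 :=
  ContinuousOn.intervalIntegrable (by rwa [uIcc_of_le zero_le_one])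

theorem intervalIntegral_congr_Ioc {f g : ℝ → ℝ} (h : ∀ y ∈ Ioc (0 : ℝ) 1, f y = g y) :
    ∫ y in (0 : ℝ)..1, f y = ∫ y in (0 : ℝ)..1, g y := by
  refine intervalIntegral.integral_congr_ae (Filter.Eventually.of_forall fun y hy => ?_)
  rw [uIoc_of_le zero_le_one] at hy
  exact h y hy

/-- A function bounded by a multiple of `y^{1/4}` and continuous on `(0, ∞)` stays continuous at the
origin. -/
theorem continuousOn_Icc_of_abs_le_rpow {g : ℝ → ℝ} {C : ℝ} (hg : ContinuousOn g (Ioi 0))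
    (h0 : g 0 = 0) (hb : ∀ y, 0 < y → |g y| ≤ C * y ^ (1 / 4 : ℝ)) : ContinuousOn g (Icc 0 1) := by
  intro y hy
  rcases hy.1.eq_or_lt with rfl | hy0
  · have hlim : Filter.Tendsto (fun y : ℝ => C * y ^ (1 / 4 : ℝ)) (nhdsWithin 0 (Icc 0 1)) (nhds 0) := by
      have : ContinuousAt (fun y : ℝ => C * y ^ (1 / 4 : ℝ)) 0 :=
        continuousAt_const.mul (Real.continuousAt_rpow_const _ _ (Or.inr (by norm_num)))
      have h := this.tendsto
      rw [Real.zero_rpow (by norm_num), mul_zero] at h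
      exact h.mono_left nhdsWithin_le_nhds
    refine ContinuousWithinAt.congr_of_eventuallyEq (f := g) ?_ (Filter.EventuallyEq.refl _ _) rfl
    rw [ContinuousWithinAt, h0]
    refine squeeze_zero_norm' ?_ hlim
    filter_upwards [self_mem_nhdsWithin] with x hx
    rcases hx.1.eq_or_lt with rfl | hx0
    · rw [h0, Real.zero_rpow (by norm_num)]; simp
    · exact hb x hx0
  · exact (hg.continuousAt (Ioi_mem_nhds hy0)).continuousWithinAt

theorem mul_rpow_neg_three_quarters {y : ℝ} (hy : 0 < y) :
    y * y ^ (-3 / 4 : ℝ) = y ^ (1 / 4 : ℝ) := by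
  rw [mul_comm, ← Real.rpow_add_one hy.ne']; norm_num

theorem continuousOn_mul_deriv_eigFun (j : ℕ) :
    ContinuousOn (fun y => y * deriv (eigFun j) y) (Icc 0 1) := by
  refine continuousOn_Icc_of_abs_le_rpow (C := 32 * modeWeight j)
    (continuousOn_id.mul (continuousOn_deriv_eigFun j)) (by simp) fun y hy => ?_
  rw [abs_mul, abs_of_pos hy, ← mul_rpow_neg_three_quarters hy]
  calc _ ≤ y * (32 * modeWeight j * y ^ (-3 / 4 : ℝ)) := by
        gcongr; exact abs_deriv_eigFun_le j hy
    _ = _ := by ring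

/-- Green's formula against a radial Dirichlet eigenfunction. -/
theorem eigVal_mul_integral (j : ℕ) {b b' : ℝ → ℝ} (hb : ContinuousOn b (Icc 0 1))
    (hb' : ContinuousOn (fun y => y * b' y) (Icc 0 1)) (hd : ∀ y ∈ Ioo (0 : ℝ) 1, HasDerivAt b (b' y) y)
    (hb1 : b 1 = 0) :
    eigVal j * ∫ y in (0 : ℝ)..1, y ^ 2 * (b y * eigFun j y)
      = ∫ y in (0 : ℝ)..1, (y * b' y) * (y * deriv (eigFun j) y) := by
  have c1 : ContinuousOn (fun y => y ^ 2 * (b y * eigFun j y)) (Icc 0 1) :=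
    (by fun_prop : ContinuousOn (fun y : ℝ => y ^ 2) (Icc 0 1)).mul
      (hb.mul (continuous_eigFun j).continuousOn)
  have c2 : ContinuousOn (fun y => (y * b' y) * (y * deriv (eigFun j) y)) (Icc 0 1) :=
    hb'.mul (continuousOn_mul_deriv_eigFun j)
  have hF := intervalIntegral.integral_eq_sub_of_hasDerivAt_of_le (a := (0 : ℝ)) (b := 1)
    zero_le_one (f := fun y => b y * eigFlux j y)
    (f' := fun y => (y * b' y) * (y * deriv (eigFun j) y)
      - eigVal j * (y ^ 2 * (b y * eigFun j y)))
    (hb.mul (continuous_eigFlux j).continuousOn) (fun y hy => by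
      refine ((hd y hy).mul (hasDerivAt_eigFlux j y)).congr_deriv ?_
      rw [← sq_mul_deriv_eigFun j hy.1.ne']
      ring)
    (c2.intervalIntegrable_zero_one.sub (c1.intervalIntegrable_zero_one.const_mul _))
  rw [intervalIntegral.integral_sub c2.intervalIntegrable_zero_one
    (c1.intervalIntegrable_zero_one.const_mul _), intervalIntegral.integral_const_mul, hb1,
    eigFlux_zero] at hF
  linarith

theorem integral_deriv_eigFun_mul (j k : ℕ) :
    4 * Real.pi * ∫ y in (0 : ℝ)..1, (y * deriv (eigFun k) y) * (y * deriv (eigFun j) y)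
      = if j = k then eigVal k else 0 := by
  rw [← eigVal_mul_integral j (continuous_eigFun k).continuousOn (continuousOn_mul_deriv_eigFun k)
    (fun y hy => (hasDerivAt_eigFun k hy.1.ne').differentiableAt.hasDerivAt) (eigFun_one k)]
  have := ballInt_eigFun_mul k j
  calc _ = eigVal j * (4 * Real.pi * ∫ y in (0 : ℝ)..1, y ^ 2 * (eigFun k y * eigFun j y)) := by ring
    _ = _ := by
      rw [this]
      rcases eq_or_ne j k with rfl | h
      · simp
      · simp [h, h.symm]

namespace ModeSummable

variable {z : ℕ → ℝ}

theorem continuousOn_mul_rho1' (hz : ModeSummable z) :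
    ContinuousOn (fun y => y * rho1' z y) (Icc 0 1) := by
  refine continuousOn_Icc_of_abs_le_rpow (C := bound z)
    (continuousOn_id.mul hz.continuousOn_rho1') (by simp) fun y hy => ?_
  rw [abs_mul, abs_of_pos hy, ← mul_rpow_neg_three_quarters hy]
  calc _ ≤ y * (bound z * y ^ (-3 / 4 : ℝ)) := by
        gcongr; exact hz.abs_rho1'_le hy
    _ = _ := by ring

theorem intervalIntegrable_rho1' (hz : ModeSummable z) :
    IntervalIntegrable (rho1' z) volume 0 1 := by
  have h := (intervalIntegral.intervalIntegrable_rpow' (a := 0) (b := 1)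
    (r := (-3 / 4 : ℝ)) (by norm_num)).const_mul (bound z)
  refine h.mono_fun' ?_ ?_
  · rw [uIoc_of_le zero_le_one]
    exact (hz.continuousOn_rho1'.mono fun y hy => hy.1).aestronglyMeasurable measurableSet_Ioc
  · rw [uIoc_of_le zero_le_one]
    refine (ae_restrict_iff' measurableSet_Ioc).2 (Filter.Eventually.of_forall fun y hy => ?_)
    exact hz.abs_rho1'_le hy.1

/-- Termwise integration of the series of the interior density. -/
theorem hasSum_integral_mul_rho1 (hz : ModeSummable z) {g : ℝ → ℝ} (hg : ContinuousOn g (Icc 0 1)) :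
    HasSum (fun j => z (j + 3) * ∫ y in (0 : ℝ)..1, g y * eigFun j y)
      (∫ y in (0 : ℝ)..1, g y * rho1 z y) := by
  obtain ⟨C, hC⟩ := isCompact_Icc.exists_bound_of_continuousOn hg
  have h := intervalIntegral.hasSum_integral_of_dominated_convergence (μ := volume) (a := (0 : ℝ))
    (b := 1) (F := fun j y => g y * (z (j + 3) * eigFun j y)) (f := fun y => g y * rho1 z y)
    (fun j _ => C * (32 * (|z (j + 3)| * modeWeight j)))
    (fun j => by
      rw [uIoc_of_le zero_le_one]
      exact ((hg.mono Ioc_subset_Icc_self).mul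
        (continuous_const.mul (continuous_eigFun j)).continuousOn).aestronglyMeasurable
        measurableSet_Ioc)
    (fun j => Filter.Eventually.of_forall fun y hy => by
      rw [uIoc_of_le zero_le_one] at hy
      rw [norm_mul]
      have h1 := hC y (Ioc_subset_Icc_self hy)
      exact mul_le_mul h1 (norm_term_le j y) (norm_nonneg _) ((norm_nonneg _).trans h1))
    (Filter.Eventually.of_forall fun _ _ => hz.summable_bound.mul_left C)
    intervalIntegrable_const
    (Filter.Eventually.of_forall fun y _ => (hz.hasSum_rho1 y).mul_left _)
  convert! h using 2 with j
  rw [← intervalIntegral.integral_const_mul]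
  exact intervalIntegral_congr_Ioc fun y _ => by ring

theorem hasSum_integral_mul_rho1' (hz : ModeSummable z) {g : ℝ → ℝ}
    (hg : ContinuousOn g (Icc 0 1)) :
    HasSum (fun j => z (j + 3) * ∫ y in (0 : ℝ)..1, g y * (y * deriv (eigFun j) y))
      (∫ y in (0 : ℝ)..1, g y * (y * rho1' z y)) := by
  obtain ⟨C, hC⟩ := isCompact_Icc.exists_bound_of_continuousOn hg
  have h := intervalIntegral.hasSum_integral_of_dominated_convergence (μ := volume) (a := (0 : ℝ))
    (b := 1) (F := fun j y => g y * (y * (z (j + 3) * deriv (eigFun j) y)))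
    (f := fun y => g y * (y * rho1' z y))
    (fun j _ => C * (32 * (|z (j + 3)| * modeWeight j)))
    (fun j => by
      rw [uIoc_of_le zero_le_one]
      refine (ContinuousOn.mul (hg.mono Ioc_subset_Icc_self) ?_).aestronglyMeasurable
        measurableSet_Ioc
      refine ((((continuousOn_mul_deriv_eigFun j).const_mul (z (j + 3))).congr fun y _ => ?_).mono
        Ioc_subset_Icc_self)
      ring)
    (fun j => Filter.Eventually.of_forall fun y hy => by
      rw [uIoc_of_le zero_le_one] at hy
      rw [norm_mul]
      have h1 := hC y (Ioc_subset_Icc_self hy)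
      refine mul_le_mul h1 ?_ (norm_nonneg _) ((norm_nonneg _).trans h1)
      rw [norm_mul, Real.norm_of_nonneg hy.1.le]
      have h2 : 0 ≤ 32 * (|z (j + 3)| * modeWeight j) := by
        have := modeWeight_nonneg j
        positivity
      calc y * ‖z (j + 3) * deriv (eigFun j) y‖
          ≤ y * (32 * (|z (j + 3)| * modeWeight j) * y ^ (-3 / 4 : ℝ)) := by
            gcongr
            · exact hy.1.le
            · exact norm_deriv_term_le j hy.1
        _ = 32 * (|z (j + 3)| * modeWeight j) * y ^ (1 / 4 : ℝ) := by
            rw [← mul_rpow_neg_three_quarters hy.1]; ring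
        _ ≤ _ := mul_le_of_le_one_right h2 (Real.rpow_le_one hy.1.le hy.2 (by norm_num)))
    (Filter.Eventually.of_forall fun _ _ => hz.summable_bound.mul_left C)
    intervalIntegrable_const
    (Filter.Eventually.of_forall fun y hy => by
      rw [uIoc_of_le zero_le_one] at hy
      exact ((hz.hasSum_rho1' hy.1).mul_left y).mul_left _)
  convert! h using 2 with j
  rw [← intervalIntegral.integral_const_mul]
  exact intervalIntegral_congr_Ioc fun y _ => by ring

/-- Integrating the series of ρ₁' term by term, only the k-th term survives, by orthogonality of the
Ξ_j'. No second derivative of ρ₁ is involved. -/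
theorem eigVal_mul_coeff (hz : ModeSummable z) (k : ℕ) :
    eigVal k * z (k + 3)
      = 4 * Real.pi * ∫ y in (0 : ℝ)..1, (y * deriv (eigFun k) y) * (y * rho1' z y) := by
  have h := (hz.hasSum_integral_mul_rho1' (continuousOn_mul_deriv_eigFun k)).mul_left (4 * Real.pi)
  have h2 : (fun j => 4 * Real.pi * (z (j + 3) *
      ∫ y in (0 : ℝ)..1, (y * deriv (eigFun k) y) * (y * deriv (eigFun j) y)))
      = fun j => if j = k then eigVal k * z (k + 3) else 0 := by
    funext j
    rw [mul_left_comm, integral_deriv_eigFun_mul]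
    split_ifs with h
    · rw [h]; ring
    · simp
  rw [h2] at h
  exact (hasSum_ite_eq k _).unique h

theorem coeff_eq_integral (hz : ModeSummable z) (k : ℕ) :
    z (k + 3) = 4 * Real.pi * ∫ y in (0 : ℝ)..1, y ^ 2 * rho1 z y * eigFun k y := by
  have h := (hz.hasSum_integral_mul_rho1 (g := fun y => y ^ 2 * eigFun k y)
    ((continuous_pow 2).mul (continuous_eigFun k)).continuousOn).mul_left (4 * Real.pi)
  have h2 : (fun j => 4 * Real.pi * (z (j + 3) *
      ∫ y in (0 : ℝ)..1, y ^ 2 * eigFun k y * eigFun j y))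
      = fun j => if j = k then z (k + 3) else 0 := by
    funext j
    have := ballInt_eigFun_mul k j
    simp only [← mul_assoc] at this ⊢
    rw [mul_right_comm, this]
    rcases eq_or_ne j k with rfl | h
    · simp
    · simp [h, h.symm]
  rw [h2] at h
  rw [(hasSum_ite_eq k _).unique h]
  congr 1
  exact intervalIntegral_congr_Ioc fun y _ => by ring

/-- Parseval's identity for the interior density. -/
theorem hasSum_coeff_sq (hz : ModeSummable z) :
    HasSum (fun k => z (k + 3) ^ 2) (4 * Real.pi * ∫ y in (0 : ℝ)..1, y ^ 2 * rho1 z y ^ 2) := by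
  have h := (hz.hasSum_integral_mul_rho1 (g := fun y => y ^ 2 * rho1 z y)
    ((continuous_pow 2).mul hz.continuous_rho1).continuousOn).mul_left (4 * Real.pi)
  convert! h using 1
  · funext k
    rw [mul_left_comm, ← hz.coeff_eq_integral, pow_two]
  · congr 1
    exact intervalIntegral_congr_Ioc fun y _ => by ring

/-- Integration of (y³ρ₁²)'; the boundary value vanishes because ρ₁(1) = 0. -/
theorem integral_rho1_mul_deriv (hz : ModeSummable z) :
    ∫ y in (0 : ℝ)..1, y ^ 2 * rho1 z y * (y * rho1' z y)
      = -(3 / 2) * ∫ y in (0 : ℝ)..1, y ^ 2 * rho1 z y ^ 2 := by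
  have c1 : ContinuousOn (fun y => y ^ 2 * rho1 z y ^ 2) (Icc 0 1) :=
    ((continuous_pow 2).mul (hz.continuous_rho1.pow 2)).continuousOn
  have c2 : ContinuousOn (fun y => y ^ 2 * rho1 z y * (y * rho1' z y)) (Icc 0 1) :=
    ((continuous_pow 2).mul hz.continuous_rho1).continuousOn.mul hz.continuousOn_mul_rho1'
  have hF := intervalIntegral.integral_eq_sub_of_hasDerivAt_of_le (a := (0 : ℝ)) (b := 1)
    zero_le_one (f := fun y => y ^ 3 * rho1 z y ^ 2)
    (f' := fun y => 3 * (y ^ 2 * rho1 z y ^ 2) + 2 * (y ^ 2 * rho1 z y * (y * rho1' z y)))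
    ((continuous_pow 3).mul (hz.continuous_rho1.pow 2)).continuousOn (fun y hy => by
      refine ((hasDerivAt_pow 3 y).mul ((hz.hasDerivAt_rho1 hy.1).pow 2)).congr_deriv ?_
      push_cast
      simp only [Pi.pow_apply]
      ring)
    ((c1.intervalIntegrable_zero_one.const_mul _).add (c2.intervalIntegrable_zero_one.const_mul _))
  rw [intervalIntegral.integral_add (c1.intervalIntegrable_zero_one.const_mul _)
    (c2.intervalIntegrable_zero_one.const_mul _), intervalIntegral.integral_const_mul,
    intervalIntegral.integral_const_mul, rho1_one] at hF
  norm_num at hF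
  linarith

/-- The integrand is one third of (y³ρ₁)' and ρ₁(1) = 0: the transport term carries no net mass. -/
theorem integral_transport (hz : ModeSummable z) :
    ∫ y in (0 : ℝ)..1, y ^ 2 * (y / 3 * rho1' z y + rho1 z y) = 0 := by
  have c1 : ContinuousOn (fun y => y ^ 2 * rho1 z y) (Icc 0 1) :=
    ((continuous_pow 2).mul hz.continuous_rho1).continuousOn
  have c2 : ContinuousOn (fun y => y ^ 2 * (y * rho1' z y)) (Icc 0 1) :=
    (continuous_pow 2).continuousOn.mul hz.continuousOn_mul_rho1'
  have hF := intervalIntegral.integral_eq_sub_of_hasDerivAt_of_le (a := (0 : ℝ)) (b := 1)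
    zero_le_one (f := fun y => 1 / 3 * (y ^ 3 * rho1 z y))
    (f' := fun y => y ^ 2 * (y / 3 * rho1' z y + rho1 z y))
    (continuous_const.mul ((continuous_pow 3).mul hz.continuous_rho1)).continuousOn (fun y hy => by
      refine (((hasDerivAt_pow 3 y).mul (hz.hasDerivAt_rho1 hy.1)).const_mul _).congr_deriv ?_
      push_cast
      ring)
    ((c1.add (c2.const_mul (1 / 3))).congr fun y _ => by
      simp only [Pi.add_apply]; ring).intervalIntegrable_zero_one
  rw [hF, rho1_one]
  simp

end ModeSummable

/-! ### Weak form of diffusion and transport, and the mass balance -/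

namespace BubbleParams

variable (P : BubbleParams)

theorem one_lt_gam : 1 < P.gam := by
  have := div_pos P.gasA_pos P.cv_pos
  unfold gam
  linarith

theorem gam_pos : 0 < P.gam := one_pos.trans P.one_lt_gam

/-- The diffusivity `κ / (γ c_v)`. -/
def diffus : ℝ := P.kap / (P.gam * P.cv)

theorem diffus_pos : 0 < P.diffus := div_pos P.kap_pos (_root_.mul_pos P.gam_pos P.cv_pos)

end BubbleParams

/-- The integral of the eigenfunction `Ξ_{j+1}` over the unit ball. -/
def massCoef (j : ℕ) : ℝ := 4 * (-1) ^ j / (Real.sqrt (2 * Real.pi) * ((j : ℝ) + 1))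

namespace Equilibrium

variable {P : BubbleParams} (S : Equilibrium P) {z : ℕ → ℝ}

theorem kbar_eq : S.kbar = P.diffus / (S.R ^ 2 * S.rho) := by
  have := S.R_pos; have := S.rho_pos; have := P.gam_pos; have := P.cv_pos
  unfold kbar BubbleParams.diffus
  field_simp

/-- The c_k are the mode coefficients of the constant function (γ - 1)/γ. Thus a source -c_k w₀ in
the interior equation is the spatially constant source -(γ - 1)/γ · w₀. -/
theorem coef_eq (j : ℕ) : S.coef j = (P.gam - 1) / P.gam * massCoef j := by
  have h2 : (2 : ℝ) ^ ((3 : ℝ) / 2) = 2 * Real.sqrt 2 := by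
    rw [Real.sqrt_eq_rpow, show (3 : ℝ) / 2 = 1 + 1 / 2 by norm_num,
      Real.rpow_add two_pos, Real.rpow_one]
  have hs : Real.sqrt 2 ^ 2 = 2 := Real.sq_sqrt two_pos.le
  have hs0 : Real.sqrt 2 ≠ 0 := by positivity
  have hp : Real.sqrt Real.pi ≠ 0 := by have := Real.pi_pos; positivity
  have hg := P.gam_pos.ne'
  unfold coef massCoef
  rw [h2, Real.sqrt_mul two_pos.le]
  field_simp
  rw [hs]
  ring

theorem dens_one : S.dens z 1 = S.rho + z 0 := by simp [dens, rho1_one]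

theorem Admissible.boundary_pos {S : Equilibrium P} (hA : S.Admissible z) : 0 < S.rho + z 0 := by
  rw [← S.dens_one]; exact hA.2 1 (by simp)

theorem continuous_dens (hz : ModeSummable z) : Continuous (S.dens z) :=
  continuous_const.add hz.continuous_rho1

theorem hasDerivAt_dens (hz : ModeSummable z) {y : ℝ} (hy : 0 < y) :
    HasDerivAt (S.dens z) (rho1' z y) y := by
  exact (hz.hasDerivAt_rho1 hy).const_add (S.rho + z 0)

theorem continuousOn_inv_dens (hz : ModeSummable z) (hA : S.Admissible z) :
    ContinuousOn (fun y => (S.dens z y)⁻¹) (Icc 0 1) :=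
  (S.continuous_dens hz).continuousOn.inv₀ fun y hy => (hA.2 y hy).ne'

/-- The coefficients of the heat flux `R⁻² κ/(γ c_v) Δ log ρ` in weak form. -/
theorem diffusion_coeff (hz : ModeSummable z) (hA : S.Admissible z) (k : ℕ) :
    S.pi0 z k - S.kbar * eigVal k * z (k + 3) = -(P.diffus / S.rad z ^ 2 * (4 * Real.pi)) *
      ∫ y in (0 : ℝ)..1, (S.dens z y)⁻¹ * (y * rho1' z y) * (y * deriv (eigFun k) y) := by
  have hR := hA.1
  have hR0 := S.R_pos
  have hρ0 := S.rho_pos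
  have hci := S.continuousOn_inv_dens hz hA
  have hcD := hz.continuousOn_mul_rho1'
  have hcE := continuousOn_mul_deriv_eigFun k
  have hcX : ContinuousOn (eigFun k) (Icc 0 1) := (continuous_eigFun k).continuousOn
  set R := S.rad z with hRdef
  set a : ℝ → ℝ := fun y => 1 / (R ^ 2 * S.dens z y) - 1 / (S.R ^ 2 * S.rho) with ha
  have ha_eq : ∀ y, a y = (R ^ 2)⁻¹ * (S.dens z y)⁻¹ - 1 / (S.R ^ 2 * S.rho) := by
    intro y; simp only [ha, one_div, mul_inv]
  have hca : ContinuousOn a (Icc 0 1) := by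
    rw [show a = _ from funext ha_eq]
    exact (hci.const_mul _).sub continuousOn_const
  -- Derivative of aΞ_k. Green's formula moves λ_j from Ξ_j to the test function aΞ_k, after which
  -- the series in j can be summed under the integral as a series of first derivatives.
  set b' : ℝ → ℝ := fun y => -((R ^ 2)⁻¹ * ((S.dens z y)⁻¹ ^ 2 * rho1' z y)) * eigFun k y
    + a y * deriv (eigFun k) y with hb'
  have hcb' : ContinuousOn (fun y => y * b' y) (Icc 0 1) := by
    have : ContinuousOn (fun y => -((R ^ 2)⁻¹ * ((S.dens z y)⁻¹ ^ 2 * (y * rho1' z y))) * eigFun k y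
        + a y * (y * deriv (eigFun k) y)) (Icc 0 1) :=
      ((((hci.pow 2).mul hcD).const_mul _).neg.mul hcX).add (hca.mul hcE)
    refine this.congr fun y _ => ?_
    simp only [hb']; ring
  have hd : ∀ y ∈ Ioo (0 : ℝ) 1, HasDerivAt (fun y => a y * eigFun k y) (b' y) y := by
    intro y hy
    have hpos := hA.2 y (Ioo_subset_Icc_self hy)
    have h1 : HasDerivAt a (-((R ^ 2)⁻¹ * ((S.dens z y)⁻¹ ^ 2 * rho1' z y))) y := by
      rw [show a = _ from funext ha_eq]
      refine ((((S.hasDerivAt_dens hz hy.1).inv hpos.ne').const_mul _).sub_const _).congr_deriv ?_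
      field_simp
    exact h1.mul (hasDerivAt_eigFun k hy.1.ne').differentiableAt.hasDerivAt
  have hsum := (hz.hasSum_integral_mul_rho1' hcb').mul_left (4 * Real.pi)
  have hseries : ∑' j, eigVal j * z (j + 3) * ballInt (fun y => a y * eigFun j y * eigFun k y)
      = 4 * Real.pi * ∫ y in (0 : ℝ)..1, (y * b' y) * (y * rho1' z y) := by
    rw [← hsum.tsum_eq]
    refine tsum_congr fun j => ?_
    rw [← eigVal_mul_integral j (hca.mul hcX) hcb' hd (by simp [eigFun_one])]
    have : (∫ y in (0 : ℝ)..1, y ^ 2 * (a y * eigFun j y * eigFun k y))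
        = ∫ y in (0 : ℝ)..1, y ^ 2 * ((a * eigFun k) y * eigFun j y) :=
      intervalIntegral_congr_Ioc fun y _ => by simp only [Pi.mul_apply]; ring
    unfold ballInt
    rw [this]
    ring
  have hflux : S.kbar * eigVal k * z (k + 3) = P.diffus * (1 / (S.R ^ 2 * S.rho)) * (4 * Real.pi) *
      ∫ y in (0 : ℝ)..1, (y * deriv (eigFun k) y) * (y * rho1' z y) := by
    rw [mul_assoc, hz.eigVal_mul_coeff, S.kbar_eq]; ring
  have i1 : IntervalIntegrable (fun y => y ^ 2 * (rho1' z y ^ 2 / (R ^ 2 * S.dens z y ^ 2) * eigFun k y))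
      volume 0 1 := by
    refine ContinuousOn.intervalIntegrable_zero_one ?_
    have : ContinuousOn (fun y => (y * rho1' z y) ^ 2 * ((R ^ 2)⁻¹ * (S.dens z y)⁻¹ ^ 2) * eigFun k y)
      (Icc 0 1) := ((hcD.pow 2).mul ((hci.pow 2).const_mul _)).mul hcX
    refine this.congr fun y _ => ?_
    simp only [div_eq_mul_inv, mul_inv, inv_pow]
    ring
  have i2 : IntervalIntegrable (fun y => (y * b' y) * (y * rho1' z y)) volume 0 1 :=
    (hcb'.mul hcD).intervalIntegrable_zero_one
  have i3 : IntervalIntegrable (fun y => (1 / (S.R ^ 2 * S.rho)) *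
      ((y * deriv (eigFun k) y) * (y * rho1' z y))) volume 0 1 :=
    ((hcE.mul hcD).const_mul _).intervalIntegrable_zero_one
  -- Pointwise cancellation: the squared gradient cancels the part of b' coming from the derivative
  -- of 1/ρ, and the linear flux cancels the frozen coefficient 1/(R†²ρ†) inside a.
  have hcomb : (∫ y in (0 : ℝ)..1, y ^ 2 * (rho1' z y ^ 2 / (R ^ 2 * S.dens z y ^ 2) * eigFun k y))
      + (∫ y in (0 : ℝ)..1, (y * b' y) * (y * rho1' z y))
      + (1 / (S.R ^ 2 * S.rho)) * (∫ y in (0 : ℝ)..1, (y * deriv (eigFun k) y) * (y * rho1' z y))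
      = (R ^ 2)⁻¹ *
        ∫ y in (0 : ℝ)..1, (S.dens z y)⁻¹ * (y * rho1' z y) * (y * deriv (eigFun k) y) := by
    rw [← intervalIntegral.integral_const_mul, ← intervalIntegral.integral_add i1 i2,
      ← intervalIntegral.integral_add (i1.add i2) i3, ← intervalIntegral.integral_const_mul]
    refine intervalIntegral_congr_Ioc fun y _ => ?_
    simp only [hb', ha_eq, div_eq_mul_inv, mul_inv, inv_pow]
    ring
  have hpi : S.pi0 z k = -P.diffus * (4 * Real.pi *
        ∫ y in (0 : ℝ)..1, y ^ 2 * (rho1' z y ^ 2 / (R ^ 2 * S.dens z y ^ 2) * eigFun k y))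
      - P.diffus * (4 * Real.pi * ∫ y in (0 : ℝ)..1, (y * b' y) * (y * rho1' z y)) := by
    rw [← hseries]
    rfl
  rw [hpi, hflux, div_eq_mul_inv]
  linear_combination (-(P.diffus * (4 * Real.pi))) * hcomb

/-- The heat flux dissipates the `L²` norm of the interior density. -/
theorem exists_hasSum_diffusion_nonpos (hz : ModeSummable z) (hA : S.Admissible z) :
    ∃ d ≤ 0, HasSum (fun k => z (k + 3) * (S.pi0 z k - S.kbar * eigVal k * z (k + 3))) d := by
  have hc : ContinuousOn (fun y => (S.dens z y)⁻¹ * (y * rho1' z y)) (Icc 0 1) :=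
    (S.continuousOn_inv_dens hz hA).mul hz.continuousOn_mul_rho1'
  refine ⟨_, ?_, ((hz.hasSum_integral_mul_rho1' hc).mul_left
    (-(P.diffus / S.rad z ^ 2 * (4 * Real.pi)))).congr_fun ?_⟩
  · refine mul_nonpos_of_nonpos_of_nonneg ?_ ?_
    · have := P.diffus_pos; have := Real.pi_pos
      exact neg_nonpos.2 (by positivity)
    · refine intervalIntegral.integral_nonneg zero_le_one fun y hy => ?_
      have := hA.2 y hy
      rw [mul_assoc]
      exact mul_nonneg (inv_nonneg.2 this.le) (mul_self_nonneg _)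
  · intro k
    rw [S.diffusion_coeff hz hA]
    ring

theorem ballInt_pi1 (z : ℕ → ℝ) (k : ℕ) :
    ballInt (fun y => S.pi1 z y * eigFun k y) = 4 * Real.pi / (P.gam * (S.rho + z 0)) *
      ∫ y in (0 : ℝ)..1, y ^ 2 * (y / 3 * rho1' z y + rho1 z y) * eigFun k y := by
  unfold ballInt pi1
  rw [div_eq_mul_one_div (4 * Real.pi), mul_assoc (4 * Real.pi),
    ← intervalIntegral.integral_const_mul (1 / (P.gam * (S.rho + z 0)))]
  congr 1
  exact intervalIntegral_congr_Ioc fun y _ => by ring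

theorem continuousOn_transport (hz : ModeSummable z) :
    ContinuousOn (fun y => y ^ 2 * (y / 3 * rho1' z y + rho1 z y)) (Icc 0 1) := by
  have := (continuous_pow 2).continuousOn.mul
    ((hz.continuousOn_mul_rho1'.const_mul (1 / 3)).add hz.continuous_rho1.continuousOn)
  refine this.congr fun y _ => ?_
  simp only [Pi.mul_apply, Pi.add_apply]
  ring

/-- Tested with ρ₁, the derivative part contributes -1/2 after integration by parts and the
undifferentiated part contributes 1, both times the squared norm of ρ₁. This explains the factor 2
in the denominator. -/
theorem hasSum_transport (hz : ModeSummable z) (hA : S.Admissible z) {s : ℝ}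
    (hs : HasSum (fun k => z (k + 3) ^ 2) s) :
    HasSum (fun k => z (k + 3) * ballInt (fun y => S.pi1 z y * eigFun k y))
      (s / (2 * P.gam * (S.rho + z 0))) := by
  have h := (hz.hasSum_integral_mul_rho1 (continuousOn_transport hz)).mul_left
    (4 * Real.pi / (P.gam * (S.rho + z 0)))
  have c1 : ContinuousOn (fun y => y ^ 2 * rho1 z y ^ 2) (Icc 0 1) :=
    ((continuous_pow 2).mul (hz.continuous_rho1.pow 2)).continuousOn
  have c2 : ContinuousOn (fun y => y ^ 2 * rho1 z y * (y * rho1' z y)) (Icc 0 1) :=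
    ((continuous_pow 2).mul hz.continuous_rho1).continuousOn.mul hz.continuousOn_mul_rho1'
  have e : (∫ y in (0 : ℝ)..1, y ^ 2 * (y / 3 * rho1' z y + rho1 z y) * rho1 z y)
      = 1 / 2 * ∫ y in (0 : ℝ)..1, y ^ 2 * rho1 z y ^ 2 := by
    have : (∫ y in (0 : ℝ)..1, y ^ 2 * (y / 3 * rho1' z y + rho1 z y) * rho1 z y)
        = ∫ y in (0 : ℝ)..1, (y ^ 2 * rho1 z y ^ 2 + 1 / 3 * (y ^ 2 * rho1 z y * (y * rho1' z y))) :=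
      intervalIntegral_congr_Ioc fun y _ => by ring
    rw [this, intervalIntegral.integral_add c1.intervalIntegrable_zero_one
      (c2.intervalIntegrable_zero_one.const_mul _), intervalIntegral.integral_const_mul,
      hz.integral_rho1_mul_deriv]
    ring
  convert! h using 1
  · funext k
    rw [S.ballInt_pi1]
    ring
  · rw [e, hs.unique hz.hasSum_coeff_sq]
    have := hA.boundary_pos.ne'
    have := P.gam_pos.ne'
    field_simp

/-- The mass balance of the interior density, with the flux through the boundary. -/
theorem hasSum_mass (hz : ModeSummable z) (hA : S.Admissible z) {m : ℝ} {τ : ℕ → ℝ}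
    (hτ : Summable fun k => τ k ^ 2)
    (h : ∀ k, τ k = S.pi0 z k - S.kbar * eigVal k * z (k + 3)
      + ballInt (fun y => S.pi1 z y * eigFun k y) * m) :
    HasSum (fun k => massCoef k * τ k)
      (4 * Real.pi * P.diffus / S.rad z ^ 2 * rho1' z 1 / (S.rho + z 0)) := by
  have hs := sqrt_two_pi_pos
  set s := Real.sqrt (2 * Real.pi) with hsdef
  have hs2 : s ^ 2 = 2 * Real.pi := Real.sq_sqrt (by have := Real.pi_pos; positivity)
  set C₁ : ℝ := P.diffus / S.rad z ^ 2 * (4 * Real.pi) with hC₁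
  set C₂ : ℝ := m * (4 * Real.pi / (P.gam * (S.rho + z 0))) with hC₂
  have hci := S.continuousOn_inv_dens hz hA
  have hcβ : ContinuousOn (fun y => (S.dens z y)⁻¹ * (y * rho1' z y)) (Icc 0 1) :=
    hci.mul hz.continuousOn_mul_rho1'
  have hcT : ContinuousOn (fun y => y * (y / 3 * rho1' z y + rho1 z y)) (Icc 0 1) := by
    have := continuousOn_id.mul
      ((hz.continuousOn_mul_rho1'.const_mul (1 / 3)).add hz.continuous_rho1.continuousOn)
    refine this.congr fun y _ => ?_
    simp only [Pi.mul_apply, Pi.add_apply, id]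
    ring
  have hiη : IntervalIntegrable (fun y => (S.dens z y)⁻¹ * rho1' z y) volume 0 1 :=
    hz.intervalIntegrable_rho1'.continuousOn_mul (by rwa [uIcc_of_le zero_le_one])
  have hηi : IntervalIntegrable (fun y => C₁ / s * ((S.dens z y)⁻¹ * rho1' z y)
      + C₂ / s * (y * (y / 3 * rho1' z y + rho1 z y))) volume 0 1 :=
    (hiη.const_mul _).add (hcT.intervalIntegrable_zero_one.const_mul _)
  have hηc : ContinuousOn (fun y => C₁ / s * ((S.dens z y)⁻¹ * rho1' z y)
      + C₂ / s * (y * (y / 3 * rho1' z y + rho1 z y))) (Ioo 0 1) :=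
    (((hci.mono Ioo_subset_Icc_self).mul (hz.continuousOn_rho1'.mono Ioo_subset_Ioi_self)).const_mul
      _).add ((hcT.mono Ioo_subset_Icc_self).const_mul _)
  -- As y²Ξ_k' is a combination of y cos and sin, the cosine part of the weak diffusion term plays
  -- the role of β, and its sine part joins the transport term in η.
  have key := hasSum_sine_coeff_pairing (hcβ.const_mul (C₁ / s)) hηi hηc hτ (fun k => by
    rw [h k, S.diffusion_coeff hz hA, S.ballInt_pi1, mul_right_comm, ← hC₁]
    have i1 : IntervalIntegrable (fun y => (C₁ / s * ((S.dens z y)⁻¹ * rho1' z y)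
        + C₂ / s * (y * (y / 3 * rho1' z y + rho1 z y))) * Real.sin (waveNum k * y)) volume 0 1 :=
      hηi.mul_continuousOn (by fun_prop)
    have i2 : IntervalIntegrable (fun y => waveNum k * ((C₁ / s * ((S.dens z y)⁻¹ * (y * rho1' z y)))
        * Real.cos (waveNum k * y))) volume 0 1 :=
      (((hcβ.const_mul _).mul (by fun_prop)).const_mul _).intervalIntegrable_zero_one
    have i3 : IntervalIntegrable (fun y => -C₁ * ((S.dens z y)⁻¹ * (y * rho1' z y) *
        (y * deriv (eigFun k) y))) volume 0 1 :=
      ((hcβ.mul (continuousOn_mul_deriv_eigFun k)).const_mul _).intervalIntegrable_zero_one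
    have i4 : IntervalIntegrable (fun y => C₂ * (y ^ 2 * (y / 3 * rho1' z y + rho1 z y) *
        eigFun k y)) volume 0 1 :=
      (((continuousOn_transport hz).mul (continuous_eigFun k).continuousOn).const_mul
        _).intervalIntegrable_zero_one
    rw [← intervalIntegral.integral_const_mul (waveNum k), ← intervalIntegral.integral_sub i1 i2,
      mul_comm _ m, ← hC₂, ← intervalIntegral.integral_const_mul,
      ← intervalIntegral.integral_const_mul, ← intervalIntegral.integral_add i3 i4]
    refine intervalIntegral_congr_Ioc fun y hy => ?_
    have hy0 := hy.1.ne'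
    have e1 : y * deriv (eigFun k) y = eigFlux k y / y := by
      rw [deriv_eigFun k hy0]; field_simp
    have e2 : eigFun k y = _ := eigFun_eq k hy0
    rw [e1, e2, eigFlux, ← hsdef]
    field_simp
    ring)
  -- The transport part integrates to zero and the rest equals the integral of β, so only the
  -- boundary value β(1) survives in `key`.
  have hη1 : (∫ y in (0 : ℝ)..1, y * (C₁ / s * ((S.dens z y)⁻¹ * rho1' z y)
      + C₂ / s * (y * (y / 3 * rho1' z y + rho1 z y))))
      = ∫ y in (0 : ℝ)..1, C₁ / s * ((S.dens z y)⁻¹ * (y * rho1' z y)) := by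
    have i1 := (hcβ.const_mul (C₁ / s)).intervalIntegrable_zero_one
    have i2 := ((continuousOn_transport hz).const_mul (C₂ / s)).intervalIntegrable_zero_one
    calc _ = ∫ y in (0 : ℝ)..1, (C₁ / s * ((S.dens z y)⁻¹ * (y * rho1' z y))
          + C₂ / s * (y ^ 2 * (y / 3 * rho1' z y + rho1 z y))) :=
          intervalIntegral_congr_Ioc fun y _ => by ring
      _ = _ := by
        rw [intervalIntegral.integral_add i1 i2, intervalIntegral.integral_const_mul (C₂ / s),
          hz.integral_transport, mul_zero, add_zero]
  rw [hη1, sub_add_cancel, S.dens_one] at key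
  -- The factor 2π/s converts the sine coefficients of y into the integrals of Ξ_k over the ball.
  have key2 := key.mul_left (2 * Real.pi / s)
  have hp := hA.boundary_pos.ne'
  have hR := hA.1.ne'
  convert! key2 using 1
  · funext k
    unfold massCoef waveNum
    rw [← hsdef]
    have := Real.pi_pos.ne'
    field_simp
    ring
  · rw [hC₁]
    field_simp
    rw [hs2]
    ring

end Equilibrium

/-! ### The mass functional on ℓ² -/

/-- Parseval for the constant 1 on the ball of volume 4π/3; in coefficients it is (8/π) ζ(2). -/
theorem hasSum_massCoef_sq : HasSum (fun k => massCoef k * massCoef k) (4 * Real.pi / 3) := by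
  have h := (hasSum_nat_add_iff' 1).2 hasSum_zeta_two
  have h2 := h.mul_left (8 / Real.pi)
  have hs : Real.sqrt (2 * Real.pi) ^ 2 = 2 * Real.pi := Real.sq_sqrt (by have := Real.pi_pos; positivity)
  convert! h2 using 1
  · funext k
    unfold massCoef
    have hsg : ((-1 : ℝ) ^ k) ^ 2 = 1 := by rw [← pow_mul, mul_comm, pow_mul]; simp
    have := sqrt_two_pi_pos.ne'
    have := Real.pi_pos.ne'
    rw [← pow_two, div_pow, mul_pow, mul_pow, hsg, hs]
    push_cast
    field_simp
    norm_num
  · have := Real.pi_pos.ne'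
    simp
    field_simp
    norm_num

theorem summable_sq_tail (a : EllTwo) : Summable fun k => a (k + 3) ^ 2 := by
  have h := (lp.memℓp a).summable (by norm_num)
  simp only [ENNReal.toReal_ofNat, Real.rpow_two, Real.norm_eq_abs, sq_abs] at h
  exact (summable_nat_add_iff 3).2 h

/-- The vector of `ℓ²` whose pairing with a state is the mass of the interior density. -/
def massVec : EllTwo := ⟨fun n => if 3 ≤ n then massCoef (n - 3) else 0, by
  refine memℓp_gen ?_
  simp only [ENNReal.toReal_ofNat, Real.rpow_two, Real.norm_eq_abs, sq_abs]
  refine (summable_nat_add_iff 3).1 ?_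
  simpa [pow_two] using hasSum_massCoef_sq.summable⟩

theorem massVec_add_three (k : ℕ) : massVec (k + 3) = massCoef k := by
  change (if 3 ≤ k + 3 then massCoef (k + 3 - 3) else 0) = _
  simp

theorem massVec_of_lt {n : ℕ} (hn : n < 3) : massVec n = 0 := by
  change (if 3 ≤ n then massCoef (n - 3) else 0) = _
  rw [if_neg (by omega)]

theorem hasSum_inner_tail (a b : EllTwo) :
    HasSum (fun k => a (k + 3) * b (k + 3))
      (inner ℝ a b - a 0 * b 0 - a 1 * b 1 - a 2 * b 2) := by
  have h0 : HasSum (fun n => (inner ℝ (a n) (b n) : ℝ)) (inner ℝ a b) :=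
    lp.hasSum_inner (𝕜 := ℝ) (G := fun _ : ℕ => ℝ) a b
  have h := (hasSum_nat_add_iff' 3).2 h0
  simp only [Finset.sum_range_succ, Finset.sum_range_zero, zero_add, RCLike.inner_apply,
    conj_trivial] at h
  convert! h using 1
  · funext k; ring
  · ring

theorem hasSum_massCoef_mul (a : EllTwo) :
    HasSum (fun k => massCoef k * a (k + 3)) (inner ℝ massVec a) := by
  have h := hasSum_inner_tail massVec a
  simpa [massVec_add_three, massVec_of_lt] using h

/-- Cauchy–Schwarz between the mass and the L² norm of ρ₁, read off from the nonnegativity of ∑ (θ_k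
- c m_k)² at the optimal c. The sharp constant 4π/3 is what `energy_coercive` takes as its
hypothesis. -/
theorem inner_massVec_sq_le (a : EllTwo) {s : ℝ} (hs : HasSum (fun k => a (k + 3) ^ 2) s) :
    inner ℝ massVec a ^ 2 ≤ 4 * Real.pi / 3 * s := by
  have hN := hasSum_massCoef_mul a
  have hM := hasSum_massCoef_sq
  set N : ℝ := inner ℝ massVec a with hNdef
  have hπ := Real.pi_pos
  set c : ℝ := N / (4 * Real.pi / 3) with hc
  have h := (hs.sub (hN.mul_left (2 * c))).add (hM.mul_left (c ^ 2))
  have h0 := h.nonneg fun k => by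
    have : a (k + 3) ^ 2 - 2 * c * (massCoef k * a (k + 3)) + c ^ 2 * (massCoef k * massCoef k)
      = (a (k + 3) - c * massCoef k) ^ 2 := by ring
    rw [this]; positivity
  have e : s - 2 * c * N + c ^ 2 * (4 * Real.pi / 3) = s - N ^ 2 / (4 * Real.pi / 3) := by
    rw [hc]; field_simp; ring
  rw [e, sub_nonneg, div_le_iff₀ (by positivity)] at h0
  linarith

/-! ### The full evolution equation, entry by entry -/

namespace Equilibrium

variable {P : BubbleParams} (S : Equilibrium P) {z w : ℕ → ℝ}

theorem Vbar_pos : 0 < S.Vbar := by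
  unfold Vbar
  have := S.V_pos; have := Real.pi_pos
  positivity

theorem lt_outer {R : ℝ} (hR : 0 < R) : R < BubbleParams.outer S.V R := by
  have h : 0 < 3 * S.V / (4 * Real.pi) := S.Vbar_pos
  unfold BubbleParams.outer
  calc R = (R ^ 3) ^ ((1 : ℝ) / 3) := by
        rw [← Real.rpow_natCast, ← Real.rpow_mul hR.le]; norm_num
    _ < _ := Real.rpow_lt_rpow (by positivity) (by linarith) (by norm_num)

/-- The unprojected evolution equation `w = ℒz + 𝒩¹(z)w + 𝒩⁰(z)` for the velocity `w = ż`. -/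
def FullEq (z w : ℕ → ℝ) : Prop := ∀ n, w n = S.linOp z n + S.nonlin1 z w n + S.nonlin0 z n

variable {S}

theorem FullEq.radius (h : S.FullEq z w) : w 1 = z 2 := by
  have := h 1
  simpa [linOp, nonlin1, nonlin0] using this

/-- Evolution of the boundary density. -/
theorem FullEq.boundary (h : S.FullEq z w) (hA : S.Admissible z) :
    S.rad z * w 0 = -3 * P.gam * (S.rho + z 0) * z 2
      - 3 * P.gam * P.diffus * rho1' z 1 / (S.rad z * (S.rho + z 0)) := by
  have h0 : w 0 = S.fac * ((∑' j, S.omg j * z (j + 3)) - z 2) + S.fac * (S.phi1 z * w 0)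
    + S.fac * S.phi0 z := h 0
  have hD : ∑' j : ℕ, Real.sqrt (Real.pi / 2) * (-1) ^ (j + 1) * ((j : ℝ) + 1) * z (j + 3)
      = rho1' z 1 := by
    unfold rho1'
    exact tsum_congr fun j => by rw [deriv_eigFun_one]; ring
  have hω : ∑' j, S.omg j * z (j + 3) = -(S.R * S.kbar / S.rho) * rho1' z 1 := by
    rw [← hD, ← tsum_mul_left]
    exact tsum_congr fun j => by unfold omg; ring
  have hR := S.R_pos.ne'
  have hρ := S.rho_pos.ne'
  have hγ := P.gam_pos.ne'
  have hp := hA.boundary_pos.ne'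
  have hr := hA.1.ne'
  have hφ : S.phi0 z = -P.diffus * (1 / (S.rad z * (S.rho + z 0) ^ 2) - 1 / (S.R * S.rho ^ 2))
      * rho1' z 1 := by
    rw [← hD]; rfl
  rw [hω, hφ, S.kbar_eq] at h0
  unfold fac phi1 at h0
  have hrad : S.rad z = S.R + z 1 := rfl
  generalize rho1' z 1 = D at *
  generalize P.diffus = K at *
  have hz1 : z 1 = S.rad z - S.R := by rw [hrad]; ring
  have hz0 : z 0 = (S.rho + z 0) - S.rho := by ring
  rw [hz1] at h0
  clear hz1 hrad hD hω hφ
  generalize S.rad z = R at *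
  generalize hpe : S.rho + z 0 = p at *
  have hz0 : z 0 = p - S.rho := by rw [← hpe]; ring
  rw [hz0] at h0
  field_simp at h0 ⊢
  -- Once the implicit term φ¹w₀ is moved to the left, the reference values ρ† and R† disappear up
  -- to the nonzero factor cancelled here.
  refine mul_left_cancel₀ (mul_ne_zero (pow_ne_zero 2 hρ) hR) ?_
  linear_combination h0

/-- Evolution of the radius velocity. -/
theorem FullEq.momentum (h : S.FullEq z w) :
    P.rhol * (S.rad z - S.rad z ^ 2 / S.radBar z) * w 2 =
      P.gasA * P.Tinf * (S.rho + z 0) - (2 * P.sig / S.rad z + 2 * P.sigbar / S.radBar z)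
      - 4 * P.mul * S.Vbar * (1 / (S.rad z * (S.rad z ^ 3 + S.Vbar))) * z 2
      - P.rhol * (3 / 2 - 2 * S.rad z / S.radBar z + S.rad z ^ 4 / (2 * S.radBar z ^ 4)) * z 2 ^ 2 := by
  have h2 : w 2 = (S.pfac * z 0
      + (2 * P.sig * S.Rbar ^ 4 + 2 * P.sigbar * S.R ^ 4)
          / (P.rhol * S.Rtil * S.R ^ 2 * S.Rbar ^ 4) * z 1
      - 4 * P.mul * S.Vbar / (P.rhol * S.Rtil * S.R * (S.R ^ 3 + S.Vbar)) * z 2)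
      + -S.pfac * (S.psi1 z * w 2) + -S.pfac * S.psi0 z := h 2
  have hR := S.R_pos
  have hV := S.Vbar_pos
  have hRb : S.R < S.Rbar := S.lt_outer hR
  have hRb0 : 0 < S.Rbar := hR.trans hRb
  have hRt : 0 < S.Rtil := by
    unfold Rtil
    rw [sub_pos, div_lt_iff₀ hRb0]
    nlinarith
  have hA' := P.gasA_pos.ne'
  have hT' := P.Tinf_pos.ne'
  have hAT := _root_.mul_pos P.gasA_pos P.Tinf_pos
  have hρl := P.rhol_pos
  have hdens : P.gasA * P.Tinf * S.rho = 2 * P.sig / S.R + 2 * P.sigbar / S.Rbar := by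
    have := S.density_eq
    change S.rho = 2 / (P.gasA * P.Tinf) * (P.sig / S.R + P.sigbar / S.Rbar) at this
    rw [this]
    field_simp
  have e1 : P.rhol * S.Rtil * S.pfac = P.gasA * P.Tinf := by
    unfold pfac; field_simp
  have e2 : P.rhol * S.Rtil * ((2 * P.sig * S.Rbar ^ 4 + 2 * P.sigbar * S.R ^ 4)
          / (P.rhol * S.Rtil * S.R ^ 2 * S.Rbar ^ 4))
      = 2 * P.sig / S.R ^ 2 + 2 * P.sigbar * S.R ^ 2 / S.Rbar ^ 4 := by
    field_simp
  have e3 : P.rhol * S.Rtil * (4 * P.mul * S.Vbar / (P.rhol * S.Rtil * S.R * (S.R ^ 3 + S.Vbar)))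
      = 4 * P.mul * S.Vbar * (1 / (S.R * (S.R ^ 3 + S.Vbar))) := by
    field_simp
  have e4 : P.gasA * P.Tinf * S.psi1 z
      = P.rhol * (z 1 + (S.R ^ 2 / S.Rbar - S.rad z ^ 2 / S.radBar z)) := by
    unfold psi1; field_simp
  have e5 : P.gasA * P.Tinf * S.psi0 z =
      4 * P.mul * S.Vbar *
        (1 / (S.rad z * (S.rad z ^ 3 + S.Vbar)) - 1 / (S.R * (S.R ^ 3 + S.Vbar))) * z 2
      + (2 * P.sig / S.R ^ 2 * z 1 + 2 * P.sig / S.rad z - 2 * P.sig / S.R)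
      + (2 * P.sigbar * S.R ^ 2 / S.Rbar ^ 4 * z 1 + 2 * P.sigbar / S.radBar z
          - 2 * P.sigbar / S.Rbar)
      + P.rhol * (3 / 2 - 2 * S.rad z / S.radBar z + S.rad z ^ 4 / (2 * S.radBar z ^ 4)) * z 2 ^ 2 := by
    unfold psi0
    rw [← mul_assoc, mul_one_div_cancel hAT.ne', one_mul]
  have hz1 : S.rad z = S.R + z 1 := rfl
  have hRt' : S.Rtil = S.R - S.R ^ 2 / S.Rbar := rfl
  have h3 : P.rhol * S.Rtil * w 2 = P.gasA * P.Tinf * z 0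
      + (2 * P.sig / S.R ^ 2 + 2 * P.sigbar * S.R ^ 2 / S.Rbar ^ 4) * z 1
      - 4 * P.mul * S.Vbar * (1 / (S.R * (S.R ^ 3 + S.Vbar))) * z 2
      - P.rhol * (z 1 + (S.R ^ 2 / S.Rbar - S.rad z ^ 2 / S.radBar z)) * w 2
      - P.gasA * P.Tinf * S.psi0 z := by
    rw [← e4]
    linear_combination P.rhol * S.Rtil * h2 + (z 0 - S.psi1 z * w 2 - S.psi0 z) * e1 + z 1 * e2 - z 2 * e3
  rw [e5] at h3
  linear_combination h3 - hdens + P.rhol * w 2 * hz1 - P.rhol * w 2 * hRt'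

/-- Evolution of the interior density. -/
theorem FullEq.interior (h : S.FullEq z w) (k : ℕ) :
    w (k + 3) = -(S.coef k * w 0) + (S.pi0 z k - S.kbar * eigVal k * z (k + 3)
      + ballInt (fun y => S.pi1 z y * eigFun k y) * w 0) := by
  have h0 : w 0 = S.fac * ((∑' j, S.omg j * z (j + 3)) - z 2) + S.fac * (S.phi1 z * w 0)
    + S.fac * S.phi0 z := h 0
  have hk : w (k + 3) = (S.coef k * S.fac * (z 2 - ∑' j, S.omg j * z (j + 3))
      - S.kbar * eigVal k * z (k + 3))
      + (ballInt (fun y => S.pi1 z y * eigFun k y) * w 0 - S.coef k * S.fac * (S.phi1 z * w 0))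
      + (S.pi0 z k - S.coef k * S.fac * S.phi0 z) := h (k + 3)
  -- Adding c_k times the zeroth equation trades the boundary flux and the velocity for -c_k w₀.
  linear_combination hk + S.coef k * h0

/-- Both the interior mass and the boundary density change through the flux ρ₁'(1). Eliminating it
between `hasSum_mass` and `FullEq.boundary` leaves a rate proportional to the radius velocity, which
the energy controls. -/
theorem FullEq.mass {z w : EllTwo} (h : S.FullEq z w) (hz : ModeSummable z) (hA : S.Admissible z) :
    4 * Real.pi / 3 * w 0 + inner ℝ massVec w
      = -(4 * Real.pi * (S.rho + z 0) / S.rad z) * z 2 := by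
  set g := (P.gam - 1) / P.gam with hg
  -- The added multiple of `massVec` removes the source -c_k w₀ and leaves diffusion plus transport.
  -- Square summability is automatic because the sum lies in ℓ².
  have hτ : Summable fun k => (w + (g * w 0) • massVec : EllTwo) (k + 3) ^ 2 := summable_sq_tail _
  have hval : ∀ k, (w + (g * w 0) • massVec : EllTwo) (k + 3) = S.pi0 z k
      - S.kbar * eigVal k * z (k + 3) + ballInt (fun y => S.pi1 z y * eigFun k y) * w 0 := by
    intro k
    change w (k + 3) + (g * w 0) * massVec (k + 3) = _
    rw [massVec_add_three, h.interior, S.coef_eq]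
    ring
  have h1 := S.hasSum_mass hz hA hτ hval
  have h2 := hasSum_massCoef_mul (w + (g * w 0) • massVec)
  have h3 := h1.unique h2
  have h4 : inner ℝ massVec massVec = 4 * Real.pi / 3 := by
    have := hasSum_massCoef_mul massVec
    simp only [massVec_add_three] at this
    exact this.unique hasSum_massCoef_sq
  rw [inner_add_right, inner_smul_right, h4] at h3
  have hb := h.boundary hA
  have hp := hA.boundary_pos.ne'
  have hr := hA.1.ne'
  have hγ := P.gam_pos.ne'
  have hb' : P.diffus * rho1' z 1 = -(S.rad z * (S.rho + z 0)) / (3 * P.gam) *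
      (S.rad z * w 0 + 3 * P.gam * (S.rho + z 0) * z 2) := by
    field_simp at hb ⊢
    linear_combination hb
  have h5 : 4 * Real.pi * P.diffus / S.rad z ^ 2 * rho1' z 1 / (S.rho + z 0)
      = 4 * Real.pi / S.rad z ^ 2 / (S.rho + z 0) * (P.diffus * rho1' z 1) := by ring
  rw [h5, hb'] at h3
  have h6 : (inner ℝ massVec w : ℝ) = 4 * Real.pi / S.rad z ^ 2 / (S.rho + z 0) *
      (-(S.rad z * (S.rho + z 0)) / (3 * P.gam) *
      (S.rad z * w 0 + 3 * P.gam * (S.rho + z 0) * z 2)) - g * w 0 * (4 * Real.pi / 3) := by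
    linarith
  rw [h6, hg]
  field_simp
  ring

/-- Testing with ρ₁: diffusion has a sign, transport gives a multiple of s, and the constant source
gives the interior mass times w₀, the one term that needs a corrected energy. -/
theorem FullEq.interior_energy {z w : EllTwo} (h : S.FullEq z w) (hz : ModeSummable z)
    (hA : S.Admissible z) {s : ℝ} (hs : HasSum (fun k => z (k + 3) ^ 2) s) :
    ∑' k, z (k + 3) * w (k + 3) ≤ -((P.gam - 1) / P.gam * inner ℝ massVec z * w 0)
      + w 0 * (s / (2 * P.gam * (S.rho + z 0))) := by
  obtain ⟨d, hd, hsum⟩ := S.exists_hasSum_diffusion_nonpos hz hA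
  have h1 := ((hasSum_massCoef_mul z).mul_left (-((P.gam - 1) / P.gam * w 0))).add
    (hsum.add ((S.hasSum_transport hz hA hs).mul_left (w 0)))
  have h2 : (fun k => z (k + 3) * w (k + 3)) = fun k =>
      -((P.gam - 1) / P.gam * w 0) * (massCoef k * z (k + 3)) +
      (z (k + 3) * (S.pi0 z k - S.kbar * eigVal k * z (k + 3)) +
        w 0 * (z (k + 3) * ballInt (fun y => S.pi1 z y * eigFun k y))) := by
    funext k
    rw [h.interior, S.coef_eq]
    ring
  rw [h2, h1.tsum_eq]
  linarith

end Equilibrium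

/-! ### Coercivity and growth of the corrected energy -/

/-- The hypothesis gives Q := (4π/3) q² - 2qn ≤ A. After multiplication by 4γ the correction costs
2(γ - 1) Q, while 2γ - 1 copies of A remain beyond the one to be kept; the surplus Q together with
the n² terms dominates q² + n². -/
theorem energy_coercive {γ A q n r v : ℝ} (hγ : 1 < γ)
    (hN : (n - 4 * Real.pi / 3 * q) ^ 2 ≤ 4 * Real.pi / 3 * A) :
    A + q ^ 2 + n ^ 2 + r ^ 2 + v ^ 2 ≤ 4 * γ * (1 / 2 * (A + r ^ 2 + v ^ 2)
      - (γ - 1) / γ * (2 * Real.pi / 3 * q ^ 2 - q * n) + n ^ 2) := by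
  have hπ := Real.pi_gt_three
  have hA : 4 * Real.pi / 3 * q ^ 2 - 2 * (q * n) ≤ A := by
    have h1 : (n - 4 * Real.pi / 3 * q) ^ 2 - n ^ 2
        = 4 * Real.pi / 3 * (4 * Real.pi / 3 * q ^ 2 - 2 * (q * n)) := by ring
    have h2 : 4 * Real.pi / 3 * (4 * Real.pi / 3 * q ^ 2 - 2 * (q * n)) ≤ 4 * Real.pi / 3 * A := by
      nlinarith [sq_nonneg n]
    exact le_of_mul_le_mul_left h2 (by positivity)
  have hγ0 : γ ≠ 0 := by positivity
  have e : 4 * γ * (1 / 2 * (A + r ^ 2 + v ^ 2)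
      - (γ - 1) / γ * (2 * Real.pi / 3 * q ^ 2 - q * n) + n ^ 2)
      = 2 * γ * (A + r ^ 2 + v ^ 2) - 4 * (γ - 1) * (2 * Real.pi / 3 * q ^ 2 - q * n)
        + 4 * γ * n ^ 2 := by
    field_simp
    ring
  rw [e]
  have h1 : (2 * γ - 1) * (4 * Real.pi / 3 * q ^ 2 - 2 * (q * n)) ≤ (2 * γ - 1) * A :=
    mul_le_mul_of_nonneg_left hA (by linarith)
  have h2 : 0 ≤ (Real.pi - 3) * q ^ 2 := mul_nonneg (by linarith) (sq_nonneg q)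
  have h3 : 0 ≤ (γ - 1) * (r ^ 2 + v ^ 2 + n ^ 2) := mul_nonneg (by linarith) (by positivity)
  nlinarith [sq_nonneg (q - n), sq_nonneg q, sq_nonneg n, sq_nonneg r, sq_nonneg v]

theorem abs_mul_mul_le {b M x v : ℝ} (hb : |b| ≤ M) : b * x * v ≤ M / 2 * (x ^ 2 + v ^ 2) := by
  have h1 : b * x * v ≤ |b| * (|x| * |v|) := by
    rw [mul_assoc, ← abs_mul, ← abs_mul]; exact le_abs_self _
  have h2 : |x| * |v| ≤ 1 / 2 * (x ^ 2 + v ^ 2) := by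
    nlinarith [sq_nonneg (|x| - |v|), sq_abs x, sq_abs v]
  calc _ ≤ |b| * (|x| * |v|) := h1
    _ ≤ M * (1 / 2 * (x ^ 2 + v ^ 2)) := by
      have := (abs_nonneg b).trans hb
      gcongr
    _ = _ := by ring

/-- The products with w₀ coming from X and from the derivative of the correction cancel. All
remaining terms are quadratic in the deviations with coefficients controlled by M, apart from r v,
which produces the extra 1. -/
theorem energy_rate_le {g A q n r v w₀ X m a b₀ b₁ b₂ M : ℝ} (hg0 : 0 ≤ g) (hg1 : g ≤ 1)
    (hA : 0 ≤ A) (hX : X ≤ -(g * (n - 4 * Real.pi / 3 * q) * w₀) + m * A)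
    (hm : |m| ≤ M) (ha : |a| ≤ M) (hb₀ : |b₀| ≤ M) (hb₁ : |b₁| ≤ M) (hb₂ : |b₂| ≤ M) :
    r * v + v * (b₀ * q + b₁ * r + b₂ * v) + X
      - g * (4 * Real.pi / 3 * q * w₀ - (w₀ * n + q * (-a * v))) + 2 * n * (-a * v)
      ≤ (5 * M + 1) * (A + q ^ 2 + n ^ 2 + r ^ 2 + v ^ 2) := by
  have hM : 0 ≤ M := (abs_nonneg _).trans hm
  have h1 : m * A ≤ M * A := mul_le_mul_of_nonneg_right ((le_abs_self m).trans hm) hA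
  have h2 := abs_mul_mul_le (x := q) (v := v) hb₀
  have h3 := abs_mul_mul_le (x := r) (v := v) hb₁
  have h4 := abs_mul_mul_le (x := v) (v := v) hb₂
  have hga : |-(g * a)| ≤ M := by
    rw [abs_neg, abs_mul, abs_of_nonneg hg0]
    exact (mul_le_of_le_one_left (abs_nonneg _) hg1).trans ha
  have h5 := abs_mul_mul_le (x := q) (v := v) hga
  have h6 := abs_mul_mul_le (M := M) (b := -a) (x := n) (v := v) (by rwa [abs_neg])
  nlinarith [sq_nonneg (r - v), mul_nonneg hM (sq_nonneg q), mul_nonneg hM (sq_nonneg n),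
    mul_nonneg hM (sq_nonneg r), mul_nonneg hM (sq_nonneg v), mul_nonneg hM hA, sq_nonneg q,
    sq_nonneg n, sq_nonneg r, sq_nonneg v]

/-! ### The kernel of ℒ and removal of the projections -/

namespace Equilibrium

variable {P : BubbleParams} (S : Equilibrium P)

theorem vecU_zero : S.vecU 0 = -S.slope := twoVec_zero _ _

theorem vecU_one : S.vecU 1 = 1 := twoVec_one _ _

theorem vecU_of_two_le (n : ℕ) : S.vecU (n + 2) = 0 := twoVec_of_two_le _ _ n

theorem Rtil_pos : 0 < S.Rtil := by
  have hR := S.R_pos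
  have hRb : S.R < S.Rbar := S.lt_outer hR
  unfold Rtil
  rw [sub_pos, div_lt_iff₀ (hR.trans hRb)]
  nlinarith

/-- `U` spans the kernel of `ℒ`, so `ℒ` does not see the component along `U`. -/
theorem linOp_smul_vecU_add (α : ℝ) (y : EllTwo) (n : ℕ) :
    S.linOp (α • S.vecU + y : EllTwo) n = S.linOp y n := by
  have h3 : ∀ k, (α • S.vecU + y : EllTwo) (k + 2) = y (k + 2) := by
    intro k
    change α * S.vecU (k + 2) + y (k + 2) = _
    rw [S.vecU_of_two_le]; ring
  have h0 : (α • S.vecU + y : EllTwo) 0 = -(α * S.slope) + y 0 := by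
    change α * S.vecU 0 + y 0 = _
    rw [S.vecU_zero]; ring
  have h1 : (α • S.vecU + y : EllTwo) 1 = α + y 1 := by
    change α * S.vecU 1 + y 1 = _
    rw [S.vecU_one]; ring
  match n with
  | 0 => simp only [linOp, h3 0, fun j => h3 (j + 1)]
  | 1 => simp only [linOp, h3 0]
  | 2 =>
    simp only [linOp, h0, h1, h3 0]
    have := S.Rtil_pos.ne'
    have := S.R_pos.ne'
    have : S.Rbar ≠ 0 := (S.R_pos.trans (S.lt_outer S.R_pos)).ne'
    have := P.rhol_pos.ne'
    have := P.gasA_pos.ne'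
    have := P.Tinf_pos.ne'
    have e : S.pfac * S.slope = (2 * P.sig * S.Rbar ^ 4 + 2 * P.sigbar * S.R ^ 4)
          / (P.rhol * S.Rtil * S.R ^ 2 * S.Rbar ^ 4) := by
      unfold pfac slope
      field_simp
    rw [← e]
    ring
  | k + 3 => simp only [linOp, h3 0, fun j => h3 (j + 1)]

variable {S}

/-- The two projections add up to the identity whatever value the pairing series takes, and ℒ(x + y)
= ℒy as x is a multiple of U. -/
theorem fullEq_of_decomposed {x y x' y' : EllTwo} (hx : x ∈ S.spaceX)
    (h1 : ∀ n, x' n = S.proj1 (S.nonlin1 (x + y) (x' + y')) n + S.proj1 (S.nonlin0 (x + y)) n)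
    (h2 : ∀ n, y' n = S.linOp y n + S.proj2 (S.nonlin1 (x + y) (x' + y')) n
        + S.proj2 (S.nonlin0 (x + y)) n) :
    S.FullEq (x + y : EllTwo) (x' + y' : EllTwo) := by
  obtain ⟨α, rfl⟩ := Submodule.mem_span_singleton.1 hx
  intro n
  rw [S.linOp_smul_vecU_add]
  have e1 := h1 n
  have e2 := h2 n
  simp only [proj2] at e2
  rw [lp.coeFn_add (α • S.vecU) y, lp.coeFn_add x' y', Pi.add_apply, e1, e2]
  ring

end Equilibrium

/-! ### Uniqueness at spherical equilibria -/

theorem ContinuousOn.ellTwo_apply {z : ℝ → EllTwo} {s : Set ℝ} (h : ContinuousOn z s) (n : ℕ) :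
    ContinuousOn (fun t => z t n) s :=
  (lp.evalCLM ℝ (fun _ : ℕ => ℝ) 2 n).continuous.comp_continuousOn h

theorem HasDerivWithinAt.ellTwo_apply {z : ℝ → EllTwo} {w : EllTwo} {s : Set ℝ} {t : ℝ}
    (h : HasDerivWithinAt z w s t) (n : ℕ) : HasDerivWithinAt (fun t => z t n) (w n) s t :=
  (lp.evalCLM ℝ (fun _ : ℕ => ℝ) 2 n).hasFDerivAt.comp_hasDerivWithinAt t h

/-- Grönwall's inequality for a function with one-sided growth bound and zero initial value. -/
theorem nonpos_of_deriv_le_mul {E E' : ℝ → ℝ} {K b : ℝ}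
    (hd : ∀ t ∈ Icc 0 b, HasDerivWithinAt E (E' t) (Icc 0 b) t) (h0 : E 0 = 0)
    (hle : ∀ t ∈ Icc 0 b, E' t ≤ K * E t) : ∀ t ∈ Icc 0 b, E t ≤ 0 := by
  intro t ht
  have h := le_gronwallBound_of_liminf_deriv_right_le (f := E) (f' := E') (δ := 0) (K := K) (ε := 0)
    (a := 0) (b := b) (fun t ht => (hd t ht).continuousWithinAt) (fun s hs r hr => by
      have hs' : HasDerivWithinAt E (E' s) (Ici s) s :=
        (hd s (Ico_subset_Icc_self hs)).mono_of_mem_nhdsWithin (Icc_mem_nhdsGE_of_mem hs)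
      simpa only [slope_def_field, div_eq_inv_mul] using hs'.liminf_right_slope_le hr)
    h0.le (fun s hs => by simpa using hle s (Ico_subset_Icc_self hs)) t ht
  simpa [gronwallBound_ε0] using h

namespace Equilibrium

variable {P : BubbleParams} {S : Equilibrium P}

theorem outer_pos (S : Equilibrium P) {R : ℝ} (hR : 0 < R) : 0 < BubbleParams.outer S.V R :=
  hR.trans (S.lt_outer hR)

theorem differentiableAt_outer (S : Equilibrium P) {R : ℝ} (hR : 0 < R) :
    DifferentiableAt ℝ (BubbleParams.outer S.V) R := by
  have h : 0 < 3 * S.V / (4 * Real.pi) := S.Vbar_pos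
  unfold BubbleParams.outer
  refine DifferentiableAt.rpow_const (by fun_prop) (Or.inl ?_)
  positivity

/-- The capillary pressure of a bubble of radius `R`. -/
def capillary (S : Equilibrium P) (R : ℝ) : ℝ :=
  2 * P.sig / R + 2 * P.sigbar / BubbleParams.outer S.V R

theorem differentiableAt_capillary (S : Equilibrium P) {R : ℝ} (hR : 0 < R) :
    DifferentiableAt ℝ S.capillary R := by
  unfold capillary
  exact ((differentiableAt_const _).div differentiableAt_id hR.ne').add
    ((differentiableAt_const _).div (S.differentiableAt_outer hR) (S.outer_pos hR).ne')

/-- Lets a difference of capillary pressures be written as a continuous coefficient times the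
deviation of the radius, including the times when the deviation is zero. -/
theorem continuousAt_dslope_capillary (S : Equilibrium P) {R₀ R : ℝ} (h₀ : 0 < R₀) (hR : 0 < R) :
    ContinuousAt (dslope S.capillary R₀) R := by
  rcases eq_or_ne R R₀ with rfl | h
  · exact continuousAt_dslope_same.2 (S.differentiableAt_capillary h₀)
  · exact (continuousAt_dslope_of_ne h).2 (S.differentiableAt_capillary hR).continuousAt

/-- A solution of the full system that starts at a spherical equilibrium stays there. -/
theorem eq_of_fullEq {T : ℝ} {z w : ℝ → EllTwo} (hw : ContinuousOn w (Ico 0 T))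
    (hd : ∀ t ∈ Ico 0 T, HasDerivWithinAt z (w t) (Ico 0 T) t)
    (hfull : ∀ t ∈ Ico 0 T, S.FullEq (z t) (w t)) (hadm : ∀ t ∈ Ico 0 T, S.Admissible (z t))
    (hms : ∀ t ∈ Ico 0 T, ModeSummable (z t)) (h2 : z 0 2 = 0) (hθ : ∀ k, z 0 (k + 3) = 0)
    (heq : P.gasA * P.Tinf * (S.rho + z 0 0) = S.capillary (S.rad (z 0))) {b : ℝ}
    (hb : b ∈ Ico 0 T) : z b = z 0 := by
  have hz : ContinuousOn z (Ico 0 T) := fun t ht => (hd t ht).continuousWithinAt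
  have hJ : Icc 0 b ⊆ Ico 0 T := fun t ht => ⟨ht.1, ht.2.trans_lt hb.2⟩
  have h0I : (0 : ℝ) ∈ Ico 0 T := ⟨le_rfl, hb.1.trans_lt hb.2⟩
  have hγ := P.one_lt_gam
  have hγ0 := P.gam_pos
  have hAT := _root_.mul_pos P.gasA_pos P.Tinf_pos
  set γ := P.gam with hγdef
  set g := (γ - 1) / γ with hg
  have hg0 : 0 ≤ g := div_nonneg (by linarith) hγ0.le
  have hg1 : g ≤ 1 := (div_le_one hγ0).2 (by linarith)
  set R : ℝ → ℝ := fun t => S.rad (z t) with hR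
  set p : ℝ → ℝ := fun t => S.rho + z t 0 with hp
  have hRpos : ∀ t ∈ Ico 0 T, 0 < R t := fun t ht => (hadm t ht).1
  have hppos : ∀ t ∈ Ico 0 T, 0 < p t := fun t ht => (hadm t ht).boundary_pos
  have hRc : ContinuousOn R (Ico 0 T) := (hz.ellTwo_apply 1).const_add S.R
  have hpc : ContinuousOn p (Ico 0 T) := (hz.ellTwo_apply 0).const_add S.rho
  set B : ℝ → ℝ := fun t => BubbleParams.outer S.V (R t) with hB
  have hBc : ContinuousOn B (Ico 0 T) := fun t ht =>
    (S.differentiableAt_outer (hRpos t ht)).continuousAt.comp_continuousWithinAt (hRc t ht)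
  have hBpos : ∀ t ∈ Ico 0 T, 0 < B t := fun t ht => S.outer_pos (hRpos t ht)
  have hRB : ∀ t ∈ Ico 0 T, R t < B t := fun t ht => S.lt_outer (hRpos t ht)
  set d : ℝ → ℝ := fun t => P.rhol * (R t - R t ^ 2 / B t) with hdd
  have hdpos : ∀ t ∈ Ico 0 T, 0 < d t := fun t ht => by
    refine _root_.mul_pos P.rhol_pos ?_
    rw [sub_pos, div_lt_iff₀ (hBpos t ht)]
    nlinarith [hRB t ht, hRpos t ht]
  have hdc : ContinuousOn d (Ico 0 T) :=
    (hRc.sub ((hRc.pow 2).div hBc fun t ht => (hBpos t ht).ne')).const_mul _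
  -- The functions m, a, b₀, b₁, b₂ are the coefficients of the energy inequality. They depend on
  -- the solution, m even on its velocity, but only their boundedness on [0, b] is used, which
  -- follows from continuity.
  set m : ℝ → ℝ := fun t => w t 0 / (2 * γ * p t) with hm
  have hmc : ContinuousOn m (Ico 0 T) := (hw.ellTwo_apply 0).div (hpc.const_mul _) fun t ht => by
    have := hppos t ht
    positivity
  set a : ℝ → ℝ := fun t => 4 * Real.pi * p t / R t with ha
  have hac : ContinuousOn a (Ico 0 T) := (hpc.const_mul _).div hRc fun t ht => (hRpos t ht).ne'
  set b₀ : ℝ → ℝ := fun t => P.gasA * P.Tinf / d t with hb₀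
  have hb₀c : ContinuousOn b₀ (Ico 0 T) := continuousOn_const.div hdc fun t ht => (hdpos t ht).ne'
  set b₁ : ℝ → ℝ := fun t => -(dslope S.capillary (R 0) (R t)) / d t with hb₁
  have hb₁c : ContinuousOn b₁ (Ico 0 T) := by
    refine ContinuousOn.div (ContinuousOn.neg fun t ht => ?_) hdc fun t ht => (hdpos t ht).ne'
    exact (S.continuousAt_dslope_capillary (hRpos 0 h0I) (hRpos t ht)).comp_continuousWithinAt
      (hRc t ht)
  set b₂ : ℝ → ℝ := fun t => -(4 * P.mul * S.Vbar * (1 / (R t * (R t ^ 3 + S.Vbar)))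
    + P.rhol * (3 / 2 - 2 * R t / B t + R t ^ 4 / (2 * B t ^ 4)) * z t 2) / d t with hb₂
  have hb₂c : ContinuousOn b₂ (Ico 0 T) := by
    refine ContinuousOn.div (ContinuousOn.neg ?_) hdc fun t ht => (hdpos t ht).ne'
    have hz2 := hz.ellTwo_apply 2
    have hV := S.Vbar_pos
    refine ContinuousOn.add (ContinuousOn.const_mul (continuousOn_const.div (hRc.mul
      ((hRc.pow 3).add continuousOn_const)) fun t ht => ?_) _) (ContinuousOn.mul
      (ContinuousOn.const_mul (ContinuousOn.add (continuousOn_const.sub ((hRc.const_mul 2).div hBc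
      fun t ht => (hBpos t ht).ne')) ((hRc.pow 4).div ((hBc.pow 4).const_mul 2) fun t ht => ?_)) _)
      hz2)
    · have := hRpos t ht
      change R t * (R t ^ 3 + S.Vbar) ≠ 0
      positivity
    · have := hBpos t ht
      change 2 * B t ^ 4 ≠ 0
      positivity
  obtain ⟨M, hM⟩ := isCompact_Icc.exists_bound_of_continuousOn
    (((((hmc.abs.add hac.abs).add hb₀c.abs).add hb₁c.abs).add hb₂c.abs).mono hJ)
  have hbd : ∀ t ∈ Icc 0 b, |m t| ≤ M ∧ |a t| ≤ M ∧ |b₀ t| ≤ M ∧ |b₁ t| ≤ M ∧ |b₂ t| ≤ M := by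
    intro t ht
    have h := (le_abs_self _).trans (hM t ht)
    simp only [Pi.add_apply] at h
    have h1 := abs_nonneg (m t)
    have h2 := abs_nonneg (a t)
    have h3 := abs_nonneg (b₀ t)
    have h4 := abs_nonneg (b₁ t)
    have h5 := abs_nonneg (b₂ t)
    refine ⟨?_, ?_, ?_, ?_, ?_⟩ <;> linarith
  -- Subtracting the pressure balance of the initial state makes the acceleration linear in the
  -- deviations from that state.
  have hw2 : ∀ t ∈ Ico 0 T, w t 2 = b₀ t * (z t 0 - z 0 0) + b₁ t * (z t 1 - z 0 1)
      + b₂ t * z t 2 := by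
    intro t ht
    have h : d t * w t 2 = P.gasA * P.Tinf * p t - S.capillary (R t)
        - 4 * P.mul * S.Vbar * (1 / (R t * (R t ^ 3 + S.Vbar))) * z t 2
        - P.rhol * (3 / 2 - 2 * R t / B t + R t ^ 4 / (2 * B t ^ 4)) * z t 2 ^ 2 :=
      (hfull t ht).momentum
    have hs : (z t 1 - z 0 1) * dslope S.capillary (R 0) (R t)
        = S.capillary (R t) - S.capillary (R 0) := by
      rw [← sub_smul_dslope S.capillary (R 0) (R t), smul_eq_mul]
      simp only [hR, rad]
      ring
    have hd0 := (hdpos t ht).ne'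
    simp only [hb₀, hb₁, hb₂]
    have heq' : P.gasA * P.Tinf * p 0 = S.capillary (R 0) := heq
    have hpp : p t = p 0 + (z t 0 - z 0 0) := by simp only [hp]; ring
    have hfrac : ∀ D X Y W q r v : ℝ, D ≠ 0 →
        D * (X / D * q + Y / D * r + W / D * v) = X * q + Y * r + W * v := by
      intro D X Y W q r v hD
      field_simp
    refine mul_left_cancel₀ hd0 ?_
    rw [h, hpp, hfrac _ _ _ _ _ _ _ hd0]
    linear_combination heq' + hs
  set Z : ℝ → EllTwo := fun t => z t - z 0 with hZ
  have hZn : ∀ t n, Z t n = z t n - z 0 n := fun t n => rfl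
  have hZ3 : ∀ t k, Z t (k + 3) = z t (k + 3) := fun t k => by rw [hZn, hθ]; ring
  have hZd : ∀ t ∈ Ico 0 T, HasDerivWithinAt Z (w t) (Ico 0 T) t := fun t ht =>
    (hd t ht).sub_const _
  set N : ℝ → ℝ := fun t => inner ℝ massVec (Z t) with hN
  have hNz : ∀ t, N t = inner ℝ massVec (z t) := fun t => by
    refine (hasSum_massCoef_mul (Z t)).unique ?_
    simpa only [hZ3] using hasSum_massCoef_mul (z t)
  have hNd : ∀ t ∈ Ico 0 T, HasDerivWithinAt N (inner ℝ massVec (w t)) (Ico 0 T) t := fun t ht =>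
    (innerSL ℝ massVec).hasFDerivAt.comp_hasDerivWithinAt t (hZd t ht)
  set q : ℝ → ℝ := fun t => z t 0 - z 0 0 with hq
  set n : ℝ → ℝ := fun t => 4 * Real.pi / 3 * q t + N t with hn
  -- Obtained by subtraction from an inner product in ℓ², so that its derivative comes from that of
  -- z in ℓ² and no series is differentiated term by term.
  set A : ℝ → ℝ := fun t => inner ℝ (Z t) (Z t) - q t * q t - (z t 1 - z 0 1) * (z t 1 - z 0 1)
    - z t 2 * z t 2 with hA
  have hAs : ∀ t, HasSum (fun k => z t (k + 3) ^ 2) (A t) := fun t => by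
    have h := hasSum_inner_tail (Z t) (Z t)
    simp only [hZ3, hZn, h2, sub_zero] at h
    simpa only [pow_two] using h
  have hqd : ∀ t ∈ Ico 0 T, HasDerivWithinAt q (w t 0) (Ico 0 T) t := fun t ht =>
    ((hd t ht).ellTwo_apply 0).sub_const _
  have hn' : ∀ t ∈ Ico 0 T, 4 * Real.pi / 3 * w t 0 + inner ℝ massVec (w t) = -a t * z t 2 :=
    fun t ht => (hfull t ht).mass (hms t ht) (hadm t ht)
  have hnd : ∀ t ∈ Ico 0 T, HasDerivWithinAt n (-a t * z t 2) (Ico 0 T) t := fun t ht => by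
    rw [← hn' t ht]
    exact ((hqd t ht).const_mul _).add (hNd t ht)
  -- The term with g compensates the product of interior mass and w₀, and the square of n restores
  -- positivity. The square of q is removed from the norm because its derivative would contain q w₀.
  set E : ℝ → ℝ := fun t => 1 / 2 * (inner ℝ (Z t) (Z t) - q t * q t)
    - g * (2 * Real.pi / 3 * (q t * q t) - q t * n t) + n t * n t with hE
  have hEd : ∀ t ∈ Ico 0 T, HasDerivWithinAt E
      (1 / 2 * (inner ℝ (Z t) (w t) + inner ℝ (w t) (Z t) - (w t 0 * q t + q t * w t 0))
        - g * (2 * Real.pi / 3 * (w t 0 * q t + q t * w t 0)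
          - (w t 0 * n t + q t * (-a t * z t 2)))
        + (-a t * z t 2 * n t + n t * (-a t * z t 2))) (Ico 0 T) t := fun t ht => by
    have h1 := hqd t ht
    have h3 := hnd t ht
    have h4 : HasDerivWithinAt (fun t => (inner ℝ (Z t) (Z t) : ℝ))
        (inner ℝ (Z t) (w t) + inner ℝ (w t) (Z t)) (Ico 0 T) t :=
      (hZd t ht).inner ℝ (hZd t ht)
    exact (((h4.sub (h1.mul h1)).const_mul _).sub ((((h1.mul h1).const_mul _).sub
      (h1.mul h3)).const_mul _)).add (h3.mul h3)
  have hcoer : ∀ t, A t + q t ^ 2 + n t ^ 2 + (z t 1 - z 0 1) ^ 2 + z t 2 ^ 2 ≤ 4 * γ * E t := by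
    intro t
    have hNA : (n t - 4 * Real.pi / 3 * q t) ^ 2 ≤ 4 * Real.pi / 3 * A t := by
      have : n t - 4 * Real.pi / 3 * q t = N t := by simp only [hn]; ring
      rw [this, hNz]
      exact inner_massVec_sq_le _ (hAs t)
    have h := energy_coercive (r := z t 1 - z 0 1) (v := z t 2) hγ hNA
    have e : 1 / 2 * (A t + (z t 1 - z 0 1) ^ 2 + z t 2 ^ 2)
      - (γ - 1) / γ * (2 * Real.pi / 3 * q t ^ 2 - q t * n t) + n t ^ 2 = E t := by
      simp only [hE, hA, hg]; ring
    rwa [e] at h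
  have hA0 : ∀ t, 0 ≤ A t := fun t => (hAs t).nonneg fun k => sq_nonneg _
  have hrate : ∀ t ∈ Icc 0 b,
      1 / 2 * (inner ℝ (Z t) (w t) + inner ℝ (w t) (Z t) - (w t 0 * q t + q t * w t 0))
        - g * (2 * Real.pi / 3 * (w t 0 * q t + q t * w t 0)
          - (w t 0 * n t + q t * (-a t * z t 2)))
        + (-a t * z t 2 * n t + n t * (-a t * z t 2)) ≤ (5 * M + 1) * (4 * γ) * E t := by
    intro t ht
    have htI := hJ ht
    obtain ⟨k1, k2, k3, k4, k5⟩ := hbd t ht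
    have hM0 : 0 ≤ M := (abs_nonneg _).trans k1
    have hX := (hfull t htI).interior_energy (hms t htI) (hadm t htI) (hAs t)
    have hX1 := hasSum_inner_tail (Z t) (w t)
    simp only [hZ3] at hX1
    rw [hX1.tsum_eq, ← hNz] at hX
    simp only [hZn, h2, sub_zero] at hX
    rw [(hfull t htI).radius, hw2 t htI] at hX
    have hX2 : inner ℝ (Z t) (w t) - q t * w t 0 - (z t 1 - z 0 1) * z t 2
        - z t 2 * (b₀ t * q t + b₁ t * (z t 1 - z 0 1) + b₂ t * z t 2)
        ≤ -(g * (n t - 4 * Real.pi / 3 * q t) * w t 0) + m t * A t := by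
      have e1 : n t - 4 * Real.pi / 3 * q t = N t := by simp only [hn]; ring
      have e2 : m t * A t = w t 0 * (A t / (2 * P.gam * (S.rho + z t 0))) := by
        simp only [hm, hp, hγdef]; ring
      rw [e1, e2]
      exact hX
    have h := energy_rate_le (n := n t) (r := z t 1 - z 0 1) (v := z t 2) hg0 hg1 (hA0 t) hX2
      k1 k2 k3 k4 k5
    have h' := mul_le_mul_of_nonneg_left (hcoer t) (by linarith : 0 ≤ 5 * M + 1)
    have hcomm : (inner ℝ (w t) (Z t) : ℝ) = inner ℝ (Z t) (w t) := real_inner_comm _ _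
    rw [hcomm]
    linarith
  have hE0 : E 0 = 0 := by
    simp [hE, hn, hN, hq, hZ]
  have hEb := nonpos_of_deriv_le_mul (fun t ht => (hEd t (hJ ht)).mono hJ) hE0 hrate b
    ⟨hb.1, le_rfl⟩
  have hzero := (hcoer b).trans (mul_nonpos_of_nonneg_of_nonpos (by positivity) hEb)
  have hqb := sq_nonneg (q b)
  have hnb := sq_nonneg (n b)
  have hrb := sq_nonneg (z b 1 - z 0 1)
  have hvb := sq_nonneg (z b 2)
  have hAb := hA0 b
  have hinner : (inner ℝ (Z b) (Z b) : ℝ) = 0 := by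
    have h : (inner ℝ (Z b) (Z b) : ℝ) = A b + q b ^ 2 + (z b 1 - z 0 1) ^ 2 + z b 2 ^ 2 := by
      simp only [hA]; ring
    rw [h]
    have h' : 0 ≤ A b + q b ^ 2 + (z b 1 - z 0 1) ^ 2 + z b 2 ^ 2 := by positivity
    linarith
  exact sub_eq_zero.1 (inner_self_eq_zero.1 hinner)

end Equilibrium

/-! ### Static states and constant solutions -/

theorem twoVec_eq (a b : ℝ) : twoVec a b = a • twoVec 1 0 + b • twoVec 0 1 := by
  ext n
  change twoVec a b n = a * twoVec 1 0 n + b * twoVec 0 1 n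
  match n with
  | 0 => simp [twoVec_zero]
  | 1 => simp [twoVec_one]
  | n + 2 => simp [twoVec_of_two_le]

theorem smul_twoVec (c a b : ℝ) : c • twoVec a b = twoVec (c * a) (c * b) := by
  rw [twoVec_eq a b, twoVec_eq (c * a), smul_add, smul_smul, smul_smul]

theorem twoVec_add (a b c d : ℝ) : twoVec a b + twoVec c d = twoVec (a + c) (b + d) := by
  rw [twoVec_eq a b, twoVec_eq c d, twoVec_eq (a + c), add_smul, add_smul]
  abel

/-- A curve with vanishing derivative within an interval is constant there. -/
theorem eq_of_hasDerivWithinAt_zero {F : Type*} [NormedAddCommGroup F] [NormedSpace ℝ F] {f : ℝ → F}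
    {s : Set ℝ} (hs : Convex ℝ s) (hd : ∀ t ∈ s, HasDerivWithinAt f 0 s t) {u v : ℝ} (hu : u ∈ s)
    (hv : v ∈ s) : f v = f u := by
  have := hs.norm_image_sub_le_of_norm_hasDerivWithin_le (C := 0) hd (by simp) hu hv
  rw [zero_mul] at this
  exact sub_eq_zero.1 (norm_le_zero_iff.1 this)

namespace Equilibrium

variable {P : BubbleParams} (S : Equilibrium P)

/-- The equilibrium state whose bubble has radius `R`. -/
def staticState (R : ℝ) : EllTwo :=
  twoVec (S.capillary R / (P.gasA * P.Tinf) - S.rho) (R - S.R)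

theorem staticState_zero (R : ℝ) :
    S.staticState R 0 = S.capillary R / (P.gasA * P.Tinf) - S.rho := twoVec_zero _ _

theorem staticState_one (R : ℝ) : S.staticState R 1 = R - S.R := twoVec_one _ _

theorem staticState_of_two_le (R : ℝ) (n : ℕ) : S.staticState R (n + 2) = 0 :=
  twoVec_of_two_le _ _ _

theorem staticState_two (R : ℝ) : S.staticState R 2 = 0 := S.staticState_of_two_le R 0

theorem staticState_add_three (R : ℝ) (n : ℕ) : S.staticState R (n + 3) = 0 :=
  S.staticState_of_two_le R (n + 1)

theorem AT_pos : 0 < P.gasA * P.Tinf := _root_.mul_pos P.gasA_pos P.Tinf_pos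

theorem capillary_pos {R : ℝ} (hR : 0 < R) : 0 < S.capillary R := by
  have := S.outer_pos hR
  have := P.sig_pos
  have := P.sigbar_pos
  unfold capillary
  positivity

theorem capillary_R : S.capillary S.R = P.gasA * P.Tinf * S.rho := by
  have := S.density_eq
  have hA' := P.gasA_pos.ne'
  have hT' := P.Tinf_pos.ne'
  rw [this]
  unfold capillary
  field_simp

theorem rad_staticState (R : ℝ) : S.rad (S.staticState R) = R := by
  rw [rad, staticState_one]; ring

theorem rho1_staticState (R y : ℝ) : rho1 (S.staticState R) y = 0 := by
  simp [rho1, staticState_add_three]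

theorem rho1'_staticState (R y : ℝ) : rho1' (S.staticState R) y = 0 := by
  simp [rho1', staticState_add_three]

theorem admissible_staticState {R : ℝ} (hR : 0 < R) : S.Admissible (S.staticState R) := by
  refine ⟨by rwa [S.rad_staticState], fun y _ => ?_⟩
  rw [dens, rho1_staticState, staticState_zero]
  have := div_pos (S.capillary_pos hR) (AT_pos (P := P))
  linarith

theorem nonlin1_zero (z : ℕ → ℝ) : S.nonlin1 z 0 = 0 := by
  funext n
  match n with
  | 0 => simp [nonlin1]
  | 1 => simp [nonlin1]
  | 2 => simp [nonlin1]
  | k + 3 => simp [nonlin1]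

theorem phi0_staticState (R : ℝ) : S.phi0 (S.staticState R) = 0 := by
  simp [phi0, staticState_add_three]

theorem pi0_staticState (R : ℝ) (k : ℕ) : S.pi0 (S.staticState R) k = 0 := by
  simp [pi0, staticState_add_three, rho1'_staticState, ballInt]

theorem nonlin0_staticState {R : ℝ} {n : ℕ} (hn : n ≠ 2) : S.nonlin0 (S.staticState R) n = 0 := by
  match n with
  | 0 => simp [nonlin0, phi0_staticState]
  | 1 => simp [nonlin0]
  | 2 => exact absurd rfl hn
  | k + 3 => simp [nonlin0, phi0_staticState, pi0_staticState]

theorem ups0_two : S.ups0 2 = 0 := by simp [ups0, ups]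

theorem proj1_zero (n : ℕ) : S.proj1 0 n = 0 := by simp [proj1, pairing]

/-- At a static state 𝒩⁰ lives in the velocity entry only, and there Υ₀ is zero. -/
theorem proj1_nonlin0_staticState (R : ℝ) (n : ℕ) :
    S.proj1 (S.nonlin0 (S.staticState R)) n = 0 := by
  have : pairing S.ups0 (S.nonlin0 (S.staticState R)) = 0 := by
    unfold pairing
    rw [← tsum_zero (β := ℕ)]
    refine tsum_congr fun n => ?_
    rcases eq_or_ne n 2 with rfl | hn
    · rw [S.ups0_two, zero_mul]
    · rw [S.nonlin0_staticState hn, mul_zero]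
  rw [proj1, this, zero_mul]

theorem psi0_staticState (R : ℝ) : S.psi0 (S.staticState R) =
    S.slope * (R - S.R) + (S.capillary R - S.capillary S.R) / (P.gasA * P.Tinf) := by
  have hA' := P.gasA_pos.ne'
  have hT' := P.Tinf_pos.ne'
  have hR : S.R ≠ 0 := S.R_pos.ne'
  have hb : S.Rbar ≠ 0 := (S.outer_pos S.R_pos).ne'
  have e : S.capillary S.R = 2 * P.sig / S.R + 2 * P.sigbar / S.Rbar := rfl
  have e2 : S.radBar (S.staticState R) = BubbleParams.outer S.V R := by
    rw [radBar, rad_staticState]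
  have hs : P.gasA * P.Tinf * S.slope = 2 * P.sig / S.R ^ 2 + 2 * P.sigbar * S.R ^ 2 / S.Rbar ^ 4 := by
    unfold slope
    field_simp
  have h : ∀ x, 1 / (P.gasA * P.Tinf) * x = S.slope * (R - S.R)
      + (S.capillary R - S.capillary S.R) / (P.gasA * P.Tinf) ↔
      x = P.gasA * P.Tinf * S.slope * (R - S.R) + (S.capillary R - S.capillary S.R) := by
    intro x
    field_simp
  unfold psi0
  rw [h, hs, staticState_two, staticState_one, rad_staticState, e2, e]
  unfold capillary
  ring

/-- Only the momentum entry is not immediate. There the terms linear in R - R† cancel between ℒ and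
Ψ⁰, leaving gas pressure minus capillary pressure, which is zero by the choice of the density. -/
theorem linOp_add_nonlin0_staticState (R : ℝ) (n : ℕ) :
    S.linOp (S.staticState R) n + S.nonlin0 (S.staticState R) n = 0 := by
  match n with
  | 0 => simp [linOp, nonlin0, phi0_staticState, staticState_two, staticState_add_three]
  | 1 => simp [linOp, nonlin0, staticState_two]
  | 2 =>
    have hA' := P.gasA_pos.ne'
    have hT' := P.Tinf_pos.ne'
    have := S.R_pos.ne'
    have := S.Rtil_pos.ne'
    have hb : S.Rbar ≠ 0 := (S.outer_pos S.R_pos).ne'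
    have := P.rhol_pos.ne'
    have e : (2 * P.sig * S.Rbar ^ 4 + 2 * P.sigbar * S.R ^ 4)
          / (P.rhol * S.Rtil * S.R ^ 2 * S.Rbar ^ 4) = S.pfac * S.slope := by
      unfold pfac slope
      field_simp
    simp only [linOp, nonlin0]
    rw [e, psi0_staticState, staticState_two, staticState_one, staticState_zero, capillary_R]
    field_simp
    ring
  | k + 3 => simp [linOp, nonlin0, phi0_staticState, pi0_staticState, staticState_two,
      staticState_add_three]

theorem rhoHat_eq (Rhat : ℝ → ℝ) (α : ℝ) :
    S.rhoHat Rhat α = S.capillary (Rhat α) / (P.gasA * P.Tinf) := by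
  unfold rhoHat capillary BubbleParams.outer Vbar
  ring

/-- The linear terms in h serve to cancel αU, so the sum is the equilibrium of radius R̂(α). -/
theorem hVec_add (Rhat : ℝ → ℝ) (α : ℝ) :
    α • S.vecU + S.hVec Rhat α = S.staticState (Rhat α) := by
  rw [vecU, hVec, smul_twoVec, twoVec_add, staticState, rhoHat_eq]
  congr 1 <;> ring

theorem alphaU_coe (α : ℝ) : (S.alphaU α : EllTwo) = α • S.vecU := rfl

theorem alphaU_add_hMap (Rhat : ℝ → ℝ) (α : ℝ) :
    (S.alphaU α : EllTwo) + S.hMap Rhat (S.alphaU α) = S.staticState (Rhat α) := by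
  rw [S.hMap_alphaU, alphaU_coe, hVec_add]

theorem eq_alphaU (x : S.spaceX) : x = S.alphaU ((x : EllTwo) 1) := by
  obtain ⟨a, ha⟩ := Submodule.mem_span_singleton.1 x.2
  have h1 : (x : EllTwo) 1 = a := by
    rw [← ha]
    change a * S.vecU 1 = a
    rw [S.vecU_one, mul_one]
  rw [h1]
  exact Subtype.ext ha.symm

theorem coe_add_hMap (Rhat : ℝ → ℝ) (x : S.spaceX) :
    (x : EllTwo) + S.hMap Rhat x = S.staticState (Rhat ((x : EllTwo) 1)) := by
  rw [← alphaU_add_hMap, ← eq_alphaU]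

variable {S}

/-- A solution of the decomposed system with an equilibrium as initial state is constant. -/
theorem IsSolution.const {T : ℝ} {x y : ℝ → EllTwo} (h : S.IsSolution T x y) {R : ℝ}
    (h0 : x 0 + y 0 = S.staticState R) {t : ℝ} (ht : t ∈ Ico 0 T) :
    x t + y t = S.staticState R ∧ x t = x 0 := by
  obtain ⟨x', y', hx', hy', heq⟩ := h.equation
  obtain ⟨v, -, hv⟩ := h.domain
  have hz : ∀ t ∈ Ico 0 T, x t + y t = S.staticState R := by
    intro t ht
    rw [← h0]
    refine S.eq_of_fullEq (z := fun t => x t + y t) (w := fun t => x' t + y' t) (hx'.add hy')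
      (fun t ht => (heq t ht).1.add (heq t ht).2.1)
      (fun t ht => fullEq_of_decomposed (h.mem_X t ht) (heq t ht).2.2.1 (heq t ht).2.2.2)
      h.admissible (fun t ht => modeSummable_of_sq ?_) ?_ ?_ ?_ ht
    · have hs := (lp.memℓp (v t)).summable (by norm_num)
      simp only [ENNReal.toReal_ofNat, Real.rpow_two, Real.norm_eq_abs, sq_abs] at hs
      simpa only [hv t ht] using hs
    · simp only [h0, staticState_two]
    · simp only [h0, staticState_add_three, implies_true]
    · simp only [h0, staticState_zero, rad_staticState]
      have := P.gasA_pos.ne'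
      have := P.Tinf_pos.ne'
      field_simp
      ring
  refine ⟨hz t ht, ?_⟩
  have h0I : (0 : ℝ) ∈ Ico 0 T := ⟨le_rfl, ht.1.trans_lt ht.2⟩
  refine eq_of_hasDerivWithinAt_zero (convex_Ico 0 T) (fun s hs => ?_) h0I ht
  obtain ⟨hdx, hdy, hex, -⟩ := heq s hs
  have hw : x' s + y' s = 0 := by
    have hd1 := hdx.add hdy
    have hd2 : HasDerivWithinAt (x + y) 0 (Ico 0 T) s :=
      (hasDerivWithinAt_const s _ (S.staticState R)).congr (fun u hu => hz u hu) (hz s hs)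
    exact (uniqueDiffOn_Ico 0 T s hs).eq_deriv _ hd1 hd2
  -- Constancy of x + y does not by itself fix x. But at zero total velocity 𝒩¹ drops out, and 𝒬₁𝒩⁰
  -- vanishes at a static state, so x is at rest too.
  have hx0 : x' s = 0 := by
    ext n
    have e1 := hex n
    have e2 : (x s : ℕ → ℝ) + y s = (S.staticState R : ℕ → ℝ) := by
      rw [← lp.coeFn_add, hz s hs]
    have e3 : (x' s : ℕ → ℝ) + y' s = 0 := by
      rw [← lp.coeFn_add, hw]; rfl
    rw [e2, e3, nonlin1_zero, proj1_zero, proj1_nonlin0_staticState, zero_add] at e1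
    exact e1
  rwa [hx0] at hdx

variable (S)

theorem isSolution_const (Rhat : ℝ → ℝ) (hpos : ∀ α, 0 < Rhat α) (x₀ : S.spaceX) (T : ℝ) :
    S.IsSolution T (fun _ => (x₀ : EllTwo)) (fun _ => S.hMap Rhat x₀) := by
  set R := Rhat ((x₀ : EllTwo) 1) with hR
  have hz := S.coe_add_hMap Rhat x₀
  have hz' : ((x₀ : EllTwo) : ℕ → ℝ) + S.hMap Rhat x₀ = (S.staticState R : ℕ → ℝ) := by
    rw [← lp.coeFn_add, hz]
  have h00 : ((0 : EllTwo) : ℕ → ℝ) + (0 : EllTwo) = 0 := by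
    rw [← lp.coeFn_add, add_zero]; rfl
  have hlin : ∀ n, S.linOp (S.hMap Rhat x₀) n = S.linOp (S.staticState R) n := by
    intro n
    rw [hR, ← hz]
    conv_rhs => rw [S.eq_alphaU x₀, alphaU_coe, linOp_smul_vecU_add, ← S.eq_alphaU x₀]
  refine ⟨fun _ _ => x₀.2, fun _ _ => ?_, ⟨0, continuousOn_const, fun t _ j => ?_⟩,
    ⟨0, 0, continuousOn_const, continuousOn_const, fun t _ => ⟨hasDerivWithinAt_const _ _ _,
      hasDerivWithinAt_const _ _ _, fun n => ?_, fun n => ?_⟩⟩⟩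
  · have := S.admissible_staticState (hpos ((x₀ : EllTwo) 1))
    rwa [← hz] at this
  · simp only [hz, staticState_add_three, mul_zero]
    rfl
  · simp only [Pi.zero_apply]
    rw [hz', h00, nonlin1_zero, proj1_zero, proj1_nonlin0_staticState, zero_add]
    rfl
  · simp only [Pi.zero_apply, proj2]
    rw [hz', h00, nonlin1_zero, proj1_zero, proj1_nonlin0_staticState, hlin]
    have := S.linOp_add_nonlin0_staticState R n
    simp only [Pi.zero_apply]
    change (0 : ℝ) = _
    linarith

end Equilibrium

/-! ### Smoothness and tangency of the center manifold -/

namespace Equilibrium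

variable {P : BubbleParams} (S : Equilibrium P)

/-- Follows from differentiating B³ = R³ + V̄ rather than the cube root. -/
theorem deriv_outer {R : ℝ} (hR : 0 < R) :
    HasDerivAt (BubbleParams.outer S.V) (R ^ 2 / BubbleParams.outer S.V R ^ 2) R := by
  have hB := S.outer_pos hR
  have hd := (S.differentiableAt_outer hR).hasDerivAt
  set D := deriv (BubbleParams.outer S.V) R with hD
  have h3 : ∀ r, 0 < r → BubbleParams.outer S.V r ^ 3 = r ^ 3 + S.Vbar := by
    intro r hr
    have h : 0 < S.Vbar := S.Vbar_pos
    unfold BubbleParams.outer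
    rw [← Real.rpow_natCast, ← Real.rpow_mul]
    · norm_num; rfl
    · change 0 ≤ r ^ 3 + S.Vbar
      positivity
  have e1 := hd.pow 3
  have e2 : HasDerivAt (BubbleParams.outer S.V ^ 3) (3 * R ^ 2) R := by
    have h : HasDerivAt (fun r : ℝ => r ^ 3 + S.Vbar) (3 * R ^ 2) R := by
      simpa using (hasDerivAt_pow 3 R).add_const S.Vbar
    refine h.congr_of_eventuallyEq ?_
    filter_upwards [Ioi_mem_nhds hR] with r hr
    exact h3 r hr
  have e3 := e1.unique e2
  have hval : R ^ 2 / BubbleParams.outer S.V R ^ 2 = D := by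
    rw [div_eq_iff (by positivity)]
    norm_num at e3
    linarith
  rwa [hval]

/-- Identifies `slope` as minus the derivative of the equilibrium density with respect to the
radius; this is why U is tangent to the curve of equilibria. -/
theorem hasDerivAt_capillary_R :
    HasDerivAt S.capillary (-(P.gasA * P.Tinf * S.slope)) S.R := by
  have hR := S.R_pos
  have hB := S.outer_pos hR
  have h1 := (hasDerivAt_const S.R (2 * P.sig)).div (hasDerivAt_id S.R) hR.ne'
  have h2 := (hasDerivAt_const S.R (2 * P.sigbar)).div (S.deriv_outer hR) hB.ne'
  refine (h1.add h2).congr_deriv ?_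
  have hA' := P.gasA_pos.ne'
  have hT' := P.Tinf_pos.ne'
  have hb : S.Rbar = BubbleParams.outer S.V S.R := rfl
  unfold slope
  rw [hb]
  simp only [id]
  field_simp
  ring

theorem contDiff_rhoHat {Rhat : ℝ → ℝ} (hC1 : ContDiff ℝ 1 Rhat) (hpos : ∀ α, 0 < Rhat α) :
    ContDiff ℝ 1 (S.rhoHat Rhat) := by
  have hV := S.Vbar_pos
  unfold rhoHat
  refine contDiff_const.mul ((contDiff_const.div hC1 fun α => (hpos α).ne').add
    (contDiff_const.div (((hC1.pow 3).add contDiff_const).rpow_const_of_ne fun α => ?_) fun α => ?_))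
  · have := hpos α
    positivity
  · have := hpos α
    positivity

theorem rhoHat_zero {Rhat : ℝ → ℝ} (h0 : Rhat 0 = S.R) : S.rhoHat Rhat 0 = S.rho := by
  have := (AT_pos (P := P)).ne'
  rw [rhoHat_eq, h0, capillary_R, mul_div_cancel_left₀ _ this]

theorem hasDerivAt_rhoHat_zero {Rhat : ℝ → ℝ} (hC1 : ContDiff ℝ 1 Rhat) (h0 : Rhat 0 = S.R) :
    HasDerivAt (S.rhoHat Rhat) (-(S.slope * deriv Rhat 0)) 0 := by
  have hA' := P.gasA_pos.ne'
  have hT' := P.Tinf_pos.ne'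
  have hd : HasDerivAt Rhat (deriv Rhat 0) 0 :=
    (hC1.differentiable one_ne_zero 0).hasDerivAt
  have hc := S.hasDerivAt_capillary_R
  rw [← h0] at hc
  have h := (hc.comp 0 hd).div_const (P.gasA * P.Tinf)
  rw [show S.rhoHat Rhat = _ from funext (S.rhoHat_eq Rhat)]
  refine h.congr_deriv ?_
  field_simp

/-- The coordinate `α` of `x = αU`. -/
def coordX : S.spaceX →L[ℝ] ℝ :=
  (lp.evalCLM ℝ (fun _ : ℕ => ℝ) 2 1).comp S.spaceX.subtypeL

theorem coordX_alphaU (α : ℝ) : S.coordX (S.alphaU α) = α := S.alphaU_one α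

theorem alphaU_coordX (x : S.spaceX) : S.alphaU (S.coordX x) = x := (S.eq_alphaU x).symm

theorem hMap_eq (Rhat : ℝ → ℝ) (x : S.spaceX) : S.hMap Rhat x =
    (S.rhoHat Rhat (S.coordX x) + S.slope * S.coordX x - S.rho) • twoVec 1 0
      + (Rhat (S.coordX x) - S.coordX x - S.R) • twoVec 0 1 := by
  rw [← twoVec_eq]; rfl

theorem contDiff_hMap {Rhat : ℝ → ℝ} (hC1 : ContDiff ℝ 1 Rhat) (hpos : ∀ α, 0 < Rhat α) :
    ContDiff ℝ 1 (S.hMap Rhat) := by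
  rw [show S.hMap Rhat = _ from funext (S.hMap_eq Rhat)]
  have hc : ContDiff ℝ 1 S.coordX := S.coordX.contDiff
  exact ((((S.contDiff_rhoHat hC1 hpos).comp hc).add (contDiff_const.mul hc)).sub
    contDiff_const |>.smul contDiff_const).add
    ((((hC1.comp hc).sub hc).sub contDiff_const).smul contDiff_const)

theorem fderiv_hMap {Rhat : ℝ → ℝ} (hC1 : ContDiff ℝ 1 Rhat) (hpos : ∀ α, 0 < Rhat α)
    (x v : S.spaceX) : fderiv ℝ (S.hMap Rhat) x v = S.coordX v •
      twoVec (deriv (S.rhoHat Rhat) (S.coordX x) + S.slope) (deriv Rhat (S.coordX x) - 1) := by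
  have h1 : HasDerivAt (S.rhoHat Rhat) (deriv (S.rhoHat Rhat) (S.coordX x)) (S.coordX x) :=
    ((S.contDiff_rhoHat hC1 hpos).differentiable one_ne_zero _).hasDerivAt
  have h2 : HasDerivAt Rhat (deriv Rhat (S.coordX x)) (S.coordX x) :=
    (hC1.differentiable one_ne_zero _).hasDerivAt
  have hp : HasDerivAt (S.hVec Rhat) (twoVec (deriv (S.rhoHat Rhat) (S.coordX x) + S.slope)
      (deriv Rhat (S.coordX x) - 1)) (S.coordX x) := by
    rw [show S.hVec Rhat = _ from funext fun α => twoVec_eq _ _, twoVec_eq (_ + _)]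
    have h3 : HasDerivAt (fun α => S.rhoHat Rhat α + S.slope * α - S.rho)
        (deriv (S.rhoHat Rhat) (S.coordX x) + S.slope) (S.coordX x) := by
      simpa using (h1.add ((hasDerivAt_id (S.coordX x)).const_mul S.slope)).sub_const S.rho
    have h4 : HasDerivAt (fun α => Rhat α - α - S.R) (deriv Rhat (S.coordX x) - 1) (S.coordX x) :=
      (h2.sub (hasDerivAt_id (S.coordX x))).sub_const S.R
    exact (h3.smul_const (twoVec 1 0)).add (h4.smul_const (twoVec 0 1))
  have h := (hp.hasFDerivAt.comp x S.coordX.hasFDerivAt).fderiv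
  have h' : fderiv ℝ (S.hMap Rhat) x = _ := h
  rw [h']
  simp

theorem hMap_zero {Rhat : ℝ → ℝ} (h0 : Rhat 0 = S.R) : S.hMap Rhat 0 = 0 := by
  rw [hMap_eq]
  simp [S.rhoHat_zero h0, h0]

/-- Since ρ̂'(0) = -slope · R̂'(0), the derivative sends αU to (R̂'(0) - 1) αU. The condition R̂'(0)
≠ 1 is what makes its range all of X and not zero. -/
theorem range_fderiv_hMap {Rhat : ℝ → ℝ} (hC1 : ContDiff ℝ 1 Rhat) (hpos : ∀ α, 0 < Rhat α)
    (h0 : Rhat 0 = S.R) (h1 : deriv Rhat 0 ≠ 1) :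
    LinearMap.range (fderiv ℝ (S.hMap Rhat) 0 : S.spaceX →ₗ[ℝ] EllTwo) = S.spaceX := by
  have hv : ∀ v, fderiv ℝ (S.hMap Rhat) 0 v = (S.coordX v * (deriv Rhat 0 - 1)) • S.vecU := by
    intro v
    rw [S.fderiv_hMap hC1 hpos, map_zero, (S.hasDerivAt_rhoHat_zero hC1 h0).deriv, vecU,
      smul_twoVec, smul_twoVec]
    congr 1 <;> ring
  ext e
  rw [Submodule.mem_span_singleton, LinearMap.mem_range]
  constructor
  · rintro ⟨v, rfl⟩
    exact ⟨_, (hv v).symm⟩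
  · rintro ⟨a, rfl⟩
    refine ⟨S.alphaU (a / (deriv Rhat 0 - 1)), ?_⟩
    change fderiv ℝ (S.hMap Rhat) 0 _ = _
    rw [hv, coordX_alphaU, div_mul_cancel₀ _ (sub_ne_zero.2 h1)]

theorem isGlobalCenterManifold {Rhat : ℝ → ℝ} (hC1 : ContDiff ℝ 1 Rhat) (hpos : ∀ α, 0 < Rhat α)
    (h0 : Rhat 0 = S.R) (h1 : deriv Rhat 0 ≠ 1) : S.IsGlobalCenterManifold (S.hMap Rhat) where
  contDiff := S.contDiff_hMap hC1 hpos
  zero := S.hMap_zero h0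
  tangent := S.range_fderiv_hMap hC1 hpos h0 h1
  exists_solution x₀ := ⟨_, _, rfl, rfl, fun T _ => S.isSolution_const Rhat hpos x₀ T⟩
  invariant x₀ T _ x y hsol hx hy t ht := by
    have hz : x 0 + y 0 = S.staticState (Rhat ((x₀ : EllTwo) 1)) := by
      rw [hx, hy, coe_add_hMap]
    obtain ⟨e1, e2⟩ := hsol.const hz ht
    have e3 : x t = x₀ := e2.trans hx
    refine ⟨hsol.mem_X t ht, ?_⟩
    have e4 : (⟨x t, hsol.mem_X t ht⟩ : S.spaceX) = x₀ := Subtype.ext e3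
    rw [e4]
    rw [e3, ← S.coe_add_hMap Rhat x₀] at e1
    exact add_left_cancel e1

/-! ### The equation on the center manifold -/

/-- The velocity `0` satisfies the equation on the center manifold at every point. -/
theorem reducedEq_zero (Rhat : ℝ → ℝ) (x : S.spaceX) : S.ReducedEq (S.hMap Rhat) x 0 := by
  intro n
  have hz : ((x : EllTwo) : ℕ → ℝ) + S.hMap Rhat x
      = (S.staticState (Rhat ((x : EllTwo) 1)) : ℕ → ℝ) := by
    rw [← lp.coeFn_add, coe_add_hMap]
  have hw : (((0 : S.spaceX) : EllTwo) : ℕ → ℝ) + fderiv ℝ (S.hMap Rhat) x 0 = 0 := by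
    rw [map_zero, ← lp.coeFn_add, Submodule.coe_zero, add_zero]; rfl
  rw [hz, hw, nonlin1_zero, proj1_zero, proj1_nonlin0_staticState, zero_add]
  rfl

/-- The functional through which `𝒩¹(z)w` enters the equation on the center manifold when the
interior density vanishes. -/
def reducedCoef : ℝ :=
  ∑' n, S.ups0 n * (match n with
    | 0 => S.fac
    | 1 => 0
    | 2 => 0
    | k + 3 => -(S.coef k * S.fac))

theorem pairing_nonlin1_staticState (R : ℝ) (w : ℕ → ℝ) :
    pairing S.ups0 (S.nonlin1 (S.staticState R) w)
      = S.reducedCoef * (S.phi1 (S.staticState R) * w 0) := by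
  unfold pairing reducedCoef
  -- Over a field the constant factor leaves the sum without any summability, so convergence of the
  -- series in `reducedCoef` is never needed.
  rw [← tsum_mul_right]
  refine tsum_congr fun n => ?_
  match n with
  | 0 => simp only [nonlin1]; ring
  | 1 => simp only [nonlin1]; ring
  | 2 => simp only [ups0_two]; ring
  | k + 3 =>
    have : ballInt (fun y => S.pi1 (S.staticState R) y * eigFun k y) = 0 := by
      simp [ballInt, pi1, rho1_staticState, rho1'_staticState]
    simp only [nonlin1, this]
    ring

/-- Vanishing interior density lets the velocity enter through its zeroth entry alone, which is
ρ̂'(α)α̇ because the slope terms of U and of h' cancel. Entry 1 is the one to read, as U has a 1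
there. -/
theorem reducedEq_coord {Rhat : ℝ → ℝ} (hC1 : ContDiff ℝ 1 Rhat) (hpos : ∀ α, 0 < Rhat α)
    {x v : S.spaceX} (h : S.ReducedEq (S.hMap Rhat) x v) :
    S.coordX v = S.reducedCoef * S.phi1 (S.staticState (Rhat (S.coordX x)))
      * deriv (S.rhoHat Rhat) (S.coordX x) * S.coordX v := by
  have h1 := h 1
  have hz : ((x : EllTwo) : ℕ → ℝ) + S.hMap Rhat x
      = (S.staticState (Rhat (S.coordX x)) : ℕ → ℝ) := by
    rw [← lp.coeFn_add, coe_add_hMap]; rfl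
  have hw : ((v : EllTwo) : ℕ → ℝ) 0 + fderiv ℝ (S.hMap Rhat) x v 0
      = deriv (S.rhoHat Rhat) (S.coordX x) * S.coordX v := by
    rw [S.fderiv_hMap hC1 hpos, smul_twoVec, twoVec_zero]
    conv_lhs => enter [1]; rw [S.eq_alphaU v, alphaU_coe]
    change S.coordX v * S.vecU 0 + _ = _
    rw [vecU_zero]
    ring
  rw [hz, proj1_nonlin0_staticState, add_zero, proj1, vecU_one, mul_one,
    pairing_nonlin1_staticState, Pi.add_apply, hw] at h1
  refine Eq.trans h1 ?_
  ring

/-- The factor in front of α̇ contains φ¹, which vanishes at the reference equilibrium. By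
continuity it stays below 1 in absolute value near α = 0, and α̇ = μ(α)α̇ then forces α̇ = 0. -/
theorem exists_reducedEq_rigid {Rhat : ℝ → ℝ} (hC1 : ContDiff ℝ 1 Rhat) (hpos : ∀ α, 0 < Rhat α)
    (h0 : Rhat 0 = S.R) : ∃ δ > 0, ∀ x v : S.spaceX, |S.coordX x| < δ →
      S.ReducedEq (S.hMap Rhat) x v → v = 0 := by
  set μ : ℝ → ℝ := fun α => S.reducedCoef * S.phi1 (S.staticState (Rhat α))
    * deriv (S.rhoHat Rhat) α with hμ
  have hρ := S.contDiff_rhoHat hC1 hpos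
  have hρpos : ∀ α, 0 < S.rhoHat Rhat α := fun α => by
    rw [rhoHat_eq]; exact div_pos (S.capillary_pos (hpos α)) AT_pos
  have hφ : ∀ α, S.phi1 (S.staticState (Rhat α)) =
      -((Rhat α - S.R) / (3 * P.gam * S.rhoHat Rhat α))
        + S.R * (S.rhoHat Rhat α - S.rho) / (3 * P.gam * S.rho * S.rhoHat Rhat α) := by
    intro α
    rw [phi1, staticState_zero, staticState_one, ← rhoHat_eq, add_sub_cancel]
  have hcont : Continuous μ := by
    have hγ := P.gam_pos
    have hr := S.rho_pos
    simp only [hμ, hφ]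
    have c1 := hC1.continuous
    have c2 := hρ.continuous
    have c3 : Continuous (deriv (S.rhoHat Rhat)) := hρ.continuous_deriv le_rfl
    refine (continuous_const.mul (Continuous.add (Continuous.neg ?_) ?_)).mul c3
    · refine (c1.sub continuous_const).div (continuous_const.mul c2) fun α => ?_
      have := hρpos α
      positivity
    · refine (continuous_const.mul (c2.sub continuous_const)).div (continuous_const.mul c2)
        fun α => ?_
      have := hρpos α
      positivity
  have hμ0 : μ 0 = 0 := by
    simp only [hμ, hφ, h0, S.rhoHat_zero h0]
    simp
  obtain ⟨δ, hδ, hball⟩ := Metric.continuousAt_iff.1 (hcont.continuousAt (x := 0)) 1 one_pos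
  refine ⟨δ, hδ, fun x v hx hv => ?_⟩
  have h1 := S.reducedEq_coord hC1 hpos hv
  have h2 : |μ (S.coordX x)| < 1 := by
    have := hball (x := S.coordX x) (by simpa [Real.dist_eq] using hx)
    simpa [Real.dist_eq, hμ0] using this
  have h3 : (1 - μ (S.coordX x)) * S.coordX v = 0 := by
    rw [sub_mul, one_mul, sub_eq_zero]
    exact h1
  have h4 : S.coordX v = 0 :=
    (mul_eq_zero.1 h3).resolve_left (by linarith [(abs_lt.1 h2).2] |> fun h => ne_of_gt h)
  rw [← S.alphaU_coordX v, h4]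
  exact Subtype.ext (zero_smul ℝ S.vecU)

theorem hasDerivWithinAt_alphaU {α : ℝ → ℝ} {s : Set ℝ} {t : ℝ}
    (h : HasDerivWithinAt α 0 s t) : HasDerivWithinAt (fun t => S.alphaU (α t)) 0 s t := by
  have e : (fun t => S.alphaU (α t)) = fun t => α t • S.alphaU 1 := by
    funext t
    refine Subtype.ext ?_
    change α t • S.vecU = α t • ((1 : ℝ) • S.vecU)
    rw [one_smul]
  rw [e]
  simpa using h.smul_const (S.alphaU 1)

/-- Solutions of the equation on the center manifold starting close to the origin are constant. -/
theorem IsReducedSolution.const {S : Equilibrium P} {Rhat : ℝ → ℝ} {δ : ℝ}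
    (hδ : ∀ x v : S.spaceX, |S.coordX x| < δ → S.ReducedEq (S.hMap Rhat) x v → v = 0)
    {T : ℝ} {x : ℝ → S.spaceX} (hx : S.IsReducedSolution (S.hMap Rhat) T x)
    (h0 : |S.coordX (x 0)| < δ) {t : ℝ} (ht : t ∈ Ico 0 T) : x t = x 0 := by
  have hc : ContinuousOn x (Ico 0 T) := fun t ht => by
    obtain ⟨v, hv, -⟩ := hx t ht
    exact hv.continuousWithinAt
  have hsub : Icc 0 t ⊆ Ico 0 T := fun s hs => ⟨hs.1, hs.2.trans_lt ht.2⟩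
  have hcl : IsClosed ({s | x s = x 0} ∩ Icc 0 t) := by
    rw [inter_comm]
    exact (hc.mono hsub).preimage_isClosed_of_isClosed isClosed_Icc isClosed_singleton
  -- Continuous induction: the set where x equals its initial value is closed. To the right of each
  -- of its points x stays for a while in the region of rigidity, where its velocity vanishes.
  refine hcl.Icc_subset_of_forall_mem_nhdsWithin rfl (fun u hu => ?_) ⟨ht.1, le_rfl⟩
  have huI : u ∈ Ico 0 T := hsub (Ico_subset_Icc_self hu.2)
  have hnear : {s | |S.coordX (x s)| < δ} ∩ Ico 0 T ∈ nhdsWithin u (Ici u) := by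
    have hIco : Ico 0 T ∈ nhdsWithin u (Ici u) :=
      Filter.mem_of_superset (Ico_mem_nhdsGE huI.2) (Ico_subset_Ico_left huI.1)
    refine Filter.inter_mem ?_ hIco
    have hcu : ContinuousWithinAt (fun s => |S.coordX (x s)|) (Ico 0 T) u :=
      (S.coordX.continuous.abs.comp_continuousOn hc) u huI
    have hcu' := hcu.mono_of_mem_nhdsWithin hIco
    refine hcu' (Iio_mem_nhds ?_)
    change |S.coordX (x u)| < δ
    rw [show x u = x 0 from hu.1]
    exact h0
  obtain ⟨r, hr, hrs⟩ := mem_nhdsGE_iff_exists_Ico_subset.1 hnear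
  have hd : ∀ s ∈ Ico u r, HasDerivWithinAt x 0 (Ico u r) s := fun s hs => by
    obtain ⟨v, hv, hred⟩ := hx s (hrs hs).2
    rw [hδ _ _ (hrs hs).1 hred] at hv
    exact hv.mono fun _ h => (hrs h).2
  have hur : Ioo u r ∈ nhdsWithin u (Ioi u) := Ioo_mem_nhdsGT hr
  filter_upwards [hur] with s hs
  have := eq_of_hasDerivWithinAt_zero (convex_Ico u r) hd ⟨le_rfl, hr⟩ (Ioo_subset_Ico_self hs)
  exact this.trans hu.1

theorem reducedLyapunovStable {Rhat : ℝ → ℝ} (hC1 : ContDiff ℝ 1 Rhat) (hpos : ∀ α, 0 < Rhat α)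
    (h0 : Rhat 0 = S.R) : S.ReducedLyapunovStable (S.hMap Rhat) := by
  have hconst : ∀ x₀ : S.spaceX, ∀ T, S.IsReducedSolution (S.hMap Rhat) T fun _ => x₀ :=
    fun x₀ T t _ => ⟨0, hasDerivWithinAt_const _ _ _, S.reducedEq_zero Rhat x₀⟩
  obtain ⟨δ, hδ, hrigid⟩ := S.exists_reducedEq_rigid hC1 hpos h0
  -- In the minimum, δ makes every solution constant, and ε then bounds it by its initial norm.
  refine ⟨fun T _ => hconst 0 T, fun ε hε => ⟨min ε δ, lt_min hε hδ, fun x₀ hx₀ =>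
    ⟨⟨_, rfl, fun T _ => hconst x₀ T⟩, fun T _ x hx hx0 t ht => ?_⟩⟩⟩
  have hcoord : |S.coordX (x 0)| < δ := by
    rw [hx0]
    exact (lp.norm_apply_le_norm two_ne_zero (x₀ : EllTwo) 1).trans_lt
      (hx₀.trans_le (min_le_right _ _))
  rw [IsReducedSolution.const hrigid hx hcoord ht, hx0]
  exact hx₀.trans_le (min_le_left _ _)

end Equilibrium

end

/-! ### Assembly of the proposition -/

theorem proposition4p4 (P : BubbleParams) (S : Equilibrium P) (Rhat : ℝ → ℝ)
    (hC1 : ContDiff ℝ 1 Rhat) (hpos : ∀ α, 0 < Rhat α)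
    (h0 : Rhat 0 = S.R) (h1 : deriv Rhat 0 ≠ 1) :
    S.rhoHat Rhat 0 = S.rho ∧
    S.IsGlobalCenterManifold (S.hMap Rhat) ∧
    (∀ T : ℝ, 0 < T → ∀ x y : ℝ → EllTwo, S.IsSolution T x y →
      (∃ α : ℝ, x 0 + y 0 = S.alphaU α + S.hMap Rhat (S.alphaU α)) →
      ∀ t ∈ Set.Ico 0 T, ∃ α : ℝ, x t + y t = S.alphaU α + S.hMap Rhat (S.alphaU α)) ∧
    (∃ δ : ℝ, 0 < δ ∧ ∀ T : ℝ, 0 < T → ∀ α : ℝ → ℝ, (∀ t ∈ Set.Ico 0 T, |α t| < δ) →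
      (S.IsReducedSolution (S.hMap Rhat) T (fun t => S.alphaU (α t)) ↔
        ∀ t ∈ Set.Ico 0 T, HasDerivWithinAt α 0 (Set.Ico 0 T) t)) ∧
    S.ReducedLyapunovStable (S.hMap Rhat) := by
  refine ⟨S.rhoHat_zero h0, S.isGlobalCenterManifold hC1 hpos h0 h1, ?_, ?_,
    S.reducedLyapunovStable hC1 hpos h0⟩
  · rintro T - x y hsol ⟨α, hα⟩ t ht
    rw [S.alphaU_add_hMap] at hα
    refine ⟨α, ?_⟩
    rw [S.alphaU_add_hMap]
    exact (hsol.const hα ht).1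
  · obtain ⟨δ, hδ, hrigid⟩ := S.exists_reducedEq_rigid hC1 hpos h0
    refine ⟨δ, hδ, fun T _ α hα => ⟨fun h t ht => ?_, fun h t ht =>
      ⟨0, S.hasDerivWithinAt_alphaU (h t ht), S.reducedEq_zero Rhat _⟩⟩⟩
    obtain ⟨v, hv, hred⟩ := h t ht
    rw [hrigid _ _ (by rw [S.coordX_alphaU]; exact hα t ht) hred] at hv
    -- Applying the coordinate functional to the curve αU recovers α, so the vanishing velocity
    -- passes to α.
    have h2 := S.coordX.hasFDerivAt.comp_hasDerivWithinAt t hv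
    simpa only [Function.comp_def, S.coordX_alphaU, map_zero] using h2
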